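/- Let $d\in\{2,3\}$, let $\Omega\subset\mathbb{R}^d$ be a bounded simply connected open set with Lipschitz boundary, and let $D\subset\Omega$ be an open set (possibly with several components) with $\mathcal{C}^2$ boundary and $\operatorname{dist}(\partial\Omega,\overline{D})>0$. Let $\gamma\in L^\infty(\partial D)$ be real-valued with $0<\gamma_{\min}\le\gamma\le\gamma_{\max}$ a.e. on $\partial D$. Function spaces are complex-valued, $H^1_0(\Omega)=\{\varphi\in H^1(\Omega):\varphi|_{\partial\Omega}=0\}$, $H^{1/2}(\partial\Omega)$ is the space of traces on $\partial\Omega$ of functions in $H^1(\Omega)$ with the norm $\|f\|=\inf\{\|u\|_{H^1(\Omega)}:u|_{\partial\Omega}=f\}$, and $H^{-1/2}(\partial\Omega)$ is its dual, realized as the bounded conjugate-linear functionals $\ell$, with $\ell(\varphi)$ written $\int_{\partial\Omega}\ell\,\overline{\varphi}\,\mathrm{d}s$. Let $[\![\partial_\nu u]\!]=\partial_\nu u^+-\partial_\nu u^-$ on $\partial D$, with $+$ the limit from $\Omega\setminus\overline{D}$, $-$ the limit from $D$, and $\nu$ the outward unit normal. All boundary value problems and normal derivatives are understood in the weak (variational)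 sense, with test functions in $H^1_0(\Omega)$ for the problems, and through Green's first identity for the normal derivatives. For every $f\in H^{1/2}(\partial\Omega)$ and $h,g\in L^2(\partial D)$, each of the following problems has a unique solution: - $u\in H^1(\Omega)$ with $-\Delta u=0$ in $\Omega\setminus\partial D$, $u|_{\partial\Omega}=f$, $[\![\partial_\nu u]\!]=\gamma u$ on $\partial D$; - $u_0\in H^1(\Omega)$ with $-\Delta u_0=0$ in $\Omega$, $u_0|_{\partial\Omega}=f$; - $w\in H^1_0(\Omega)$ with $-\Delta w=0$ in $\Omega\setminus\partial D$, $[\![\partial_\nu w]\!]=\gamma h$ on $\partial D$; - $v\in H^1_0(\Omega)$ with $-\Delta v=0$ in $\Omega\setminus\partial D$, $[\![\partial_\nu v]\!]=\gamma v+g$ on $\partial D$. The maps $$\Lambda f=\partial_\nu u|_{\partial\Omega},\quad \Lambda_0 f=\partial_\nu u_0|_{\partial\Omega},\quad Sf=u|_{\partial D},\quad Th=\gamma\,(h-w|_{\partial D})$$ are well-defined bounded linear operators $\Lambda,\Lambda_0:H^{1/2}(\partial\Omega)\to H^{-1/2}(\partial\Omega)$, $S:H^{1/2}(\partial\Omega)\to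 L^2(\partial D)$, $T:L^2(\partial D)\to L^2(\partial D)$. The adjoint $S^*:L^2(\partial D)\to H^{-1/2}(\partial\Omega)$ of $S$, defined by $(S^*g)(f)=\int_{\partial D} g\,\overline{Sf}\,\mathrm{d}s$, is given by $S^*g=\partial_\nu v|_{\partial\Omega}$. The current gap operator has the symmetric factorization $$\Lambda-\Lambda_0=S^*TS .$$ -/

import Mathlib

open MeasureTheory Set Filter Topology
open scoped ContDiff ENNReal MeasureTheory

namespace EIT

noncomputable section

/-- The Euclidean space `ℝ^d`. -/
abbrev E (d : ℕ) : Type := EuclideanSpace ℝ (Fin d)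

/-- The boundary of `s` is locally the graph of a Lipschitz function over a hyperplane, and `s`
lies locally on one side of that graph. -/
def HasLipschitzBoundary {d : ℕ} (s : Set (E d)) : Prop :=
  ∀ x ∈ frontier s, ∃ e : E d, ‖e‖ = 1 ∧ ∃ g : (Submodule.span ℝ {e})ᗮ → ℝ,
    (∃ K, LipschitzWith K g) ∧ ∃ U : Set (E d), IsOpen U ∧ x ∈ U ∧
      ∀ y ∈ U, (y ∈ s ↔ inner ℝ e y < g ((Submodule.span ℝ {e})ᗮ.orthogonalProjectionOnto y))

/-- The boundary of `s` is locally the graph of a `C²` function over a hyperplane, and `s`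
lies locally on one side of that graph. -/
def HasC2Boundary {d : ℕ} (s : Set (E d)) : Prop :=
  ∀ x ∈ frontier s, ∃ e : E d, ‖e‖ = 1 ∧ ∃ g : (Submodule.span ℝ {e})ᗮ → ℝ,
    ContDiff ℝ 2 g ∧ ∃ U : Set (E d), IsOpen U ∧ x ∈ U ∧
      ∀ y ∈ U, (y ∈ s ↔ inner ℝ e y < g ((Submodule.span ℝ {e})ᗮ.orthogonalProjectionOnto y))

/-- The surface measure `ds` on the boundary of `s`: the (normalized) `(d-1)`-dimensional
Hausdorff measure restricted to `∂s`. -/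
def surf {d : ℕ} (s : Set (E d)) : Measure (E d) :=
  (μHE[d - 1] : Measure (E d)).restrict (frontier s)

/-- The space `L²(∂s)` of complex-valued functions. -/
abbrev L2b {d : ℕ} (s : Set (E d)) : Type := Lp ℂ 2 (surf s)

/-- The space `L²(Ω) × L²(Ω)^d` with its Hilbert norm. -/
abbrev L2Pair {d : ℕ} (Ω : Set (E d)) : Type :=
  WithLp 2 (Lp ℂ 2 (volume.restrict Ω) × Lp (EuclideanSpace ℂ (Fin d)) 2 (volume.restrict Ω))

/-- The `i`-th partial derivative of a (differentiable) function. -/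
def partialD {d : ℕ} {F : Type*} [NormedAddCommGroup F] [NormedSpace ℝ F]
    (i : Fin d) (φ : E d → F) (x : E d) : F :=
  fderiv ℝ φ x (EuclideanSpace.single i 1)

/-- The gradient of a complex-valued (differentiable) function. -/
def grad {d : ℕ} (φ : E d → ℂ) (x : E d) : EuclideanSpace ℂ (Fin d) :=
  WithLp.toLp 2 (fun i => partialD i φ x)

/-- `G` is the weak gradient of `u` on `Ω`. -/
def IsWeakGrad {d : ℕ} (Ω : Set (E d)) (u : E d → ℂ) (G : E d → EuclideanSpace ℂ (Fin d)) :
    Prop :=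
  ∀ φ : E d → ℝ, ContDiff ℝ ∞ φ → HasCompactSupport φ → tsupport φ ⊆ Ω → ∀ i : Fin d,
    ∫ x in Ω, partialD i φ x • u x = - ∫ x in Ω, φ x • G x i

lemma partialD_memLp {d : ℕ} (i : Fin d) {φ : E d → ℝ} (h : ContDiff ℝ ∞ φ)
    (hc : HasCompactSupport φ) (μ : Measure (E d)) [IsFiniteMeasureOnCompacts μ] :
    MemLp (partialD i φ) 2 μ := by
  have h1 : Continuous (partialD i φ) := by
    have := h.continuous_fderiv (by simp)
    unfold partialD
    fun_prop
  have h2 : HasCompactSupport (partialD i φ) := hc.fderiv_apply ℝ _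
  exact h1.memLp_of_hasCompactSupport h2

lemma memLp_coord {d : ℕ} {μ : Measure (E d)} (G : Lp (EuclideanSpace ℂ (Fin d)) 2 μ)
    (i : Fin d) : MemLp (fun x => G x i) 2 μ :=
  (EuclideanSpace.proj (𝕜 := ℂ) i).comp_memLp' (Lp.memLp G)

lemma smulInt {α : Type*} [MeasurableSpace α] {μ : Measure α} {φ : α → ℝ} {u : α → ℂ}
    (h : MemLp φ 2 μ) (hu : MemLp u 2 μ) : Integrable (fun x => φ x • u x) μ :=
  memLp_one_iff_integrable.1 (MemLp.smul (p := 2) (q := 2) (r := 1) hu h)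

/-- The Sobolev space `H¹(Ω)` of complex-valued functions: the pairs `(u, ∇u)` in
`L²(Ω) × L²(Ω)^d`, with the norm `(‖u‖² + ‖∇u‖²)^{1/2}`. -/
def H1 {d : ℕ} (Ω : Set (E d)) : Submodule ℂ (L2Pair Ω) where
  carrier := {p | IsWeakGrad Ω p.fst p.snd}
  zero_mem' := by
    intro φ hφ hc hs i
    have h1 : ∀ᵐ x ∂(volume.restrict Ω),
        (0 : Lp ℂ 2 ((volume : Measure (E d)).restrict Ω)) x = 0 := Lp.coeFn_zero _ _ _
    have h2 : ∀ᵐ x ∂(volume.restrict Ω),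
        (0 : Lp (EuclideanSpace ℂ (Fin d)) 2 ((volume : Measure (E d)).restrict Ω)) x = 0 :=
      Lp.coeFn_zero _ _ _
    rw [integral_eq_zero_of_ae, integral_eq_zero_of_ae, neg_zero]
    · filter_upwards [h2] with x hx
      change φ x • (0 : Lp (EuclideanSpace ℂ (Fin d)) 2
        ((volume : Measure (E d)).restrict Ω)) x i = 0
      rw [hx, PiLp.zero_apply, smul_zero]
    · filter_upwards [h1] with x hx
      change partialD i φ x • (0 : Lp ℂ 2 ((volume : Measure (E d)).restrict Ω)) x = 0
      rw [hx, smul_zero]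
  add_mem' := by
    intro p q hp hq φ hφ hc hs i
    have hd := partialD_memLp i hφ hc (volume.restrict Ω)
    have hv : MemLp φ 2 (volume.restrict Ω) := hφ.continuous.memLp_of_hasCompactSupport hc
    have e1 : ∫ x in Ω, partialD i φ x • (p + q).fst x
        = (∫ x in Ω, partialD i φ x • p.fst x) + ∫ x in Ω, partialD i φ x • q.fst x := by
      rw [← integral_add (smulInt hd (Lp.memLp p.fst))
        (smulInt hd (Lp.memLp q.fst))]
      refine integral_congr_ae ?_
      filter_upwards [Lp.coeFn_add p.fst q.fst] with x hx
      change partialD i φ x • (p.fst + q.fst : Lp ℂ 2 _) x = _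
      rw [hx, Pi.add_apply, smul_add]
    have e2 : ∫ x in Ω, φ x • (p + q).snd x i
        = (∫ x in Ω, φ x • p.snd x i) + ∫ x in Ω, φ x • q.snd x i := by
      rw [← integral_add (smulInt hv (memLp_coord p.snd i))
        (smulInt hv (memLp_coord q.snd i))]
      refine integral_congr_ae ?_
      filter_upwards [Lp.coeFn_add p.snd q.snd] with x hx
      change φ x • (p.snd + q.snd : Lp (EuclideanSpace ℂ (Fin d)) 2 _) x i = _
      rw [hx, Pi.add_apply, PiLp.add_apply, smul_add]
    have a1 := hp φ hφ hc hs i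
    have a2 := hq φ hφ hc hs i
    rw [e1, e2, a1, a2]
    ring
  smul_mem' := by
    intro c p hp φ hφ hc hs i
    have e1 : ∫ x in Ω, partialD i φ x • (c • p).fst x
        = c * ∫ x in Ω, partialD i φ x • p.fst x := by
      rw [← integral_const_mul]
      refine integral_congr_ae ?_
      filter_upwards [Lp.coeFn_smul c p.fst] with x hx
      change partialD i φ x • (c • p.fst : Lp ℂ 2 _) x = _
      rw [hx, Pi.smul_apply, smul_comm, smul_eq_mul]
    have e2 : ∫ x in Ω, φ x • (c • p).snd x i
        = c * ∫ x in Ω, φ x • p.snd x i := by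
      rw [← integral_const_mul]
      refine integral_congr_ae ?_
      filter_upwards [Lp.coeFn_smul c p.snd] with x hx
      change φ x • (c • p.snd : Lp (EuclideanSpace ℂ (Fin d)) 2 _) x i = _
      rw [hx, Pi.smul_apply, PiLp.smul_apply, smul_comm, smul_eq_mul]
    have a1 := hp φ hφ hc hs i
    rw [e1, e2, a1]
    ring

/-- The function underlying an element of `H¹(Ω)`. -/
def H1fn {d : ℕ} {Ω : Set (E d)} (u : H1 Ω) : Lp ℂ 2 ((volume : Measure (E d)).restrict Ω) :=
  (u : L2Pair Ω).fst

/-- The weak gradient of an element of `H¹(Ω)`. -/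
def H1grad {d : ℕ} {Ω : Set (E d)} (u : H1 Ω) :
    Lp (EuclideanSpace ℂ (Fin d)) 2 ((volume : Measure (E d)).restrict Ω) :=
  (u : L2Pair Ω).snd

/-- `τ` is the trace of `u ∈ H¹(Ω)` on `∂s`, where `∂s ⊆ closure Ω` (here `s = Ω` or `s = D`).
The trace operator is the extension by continuity of the restriction `φ ↦ φ|_{∂s}` from functions
`φ` smooth up to the boundary of `Ω`: some sequence of smooth functions converges to `u` in
`H¹(Ω)` and to `τ` in `L²(∂s)`. -/
def IsTrace {d : ℕ} {Ω : Set (E d)} (s : Set (E d)) (u : H1 Ω) (τ : L2b s) : Prop :=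
  ∃ φ : ℕ → E d → ℂ, (∀ n, ContDiff ℝ ∞ (φ n)) ∧
    Tendsto (fun n => eLpNorm (fun x => φ n x - H1fn u x) 2 (volume.restrict Ω)) atTop (𝓝 0) ∧
    Tendsto (fun n => eLpNorm (fun x => grad (φ n) x - H1grad u x) 2 (volume.restrict Ω))
      atTop (𝓝 0) ∧
    Tendsto (fun n => eLpNorm (fun x => φ n x - τ x) 2 (surf s)) atTop (𝓝 0)

lemma IsTrace.zero {d : ℕ} {Ω : Set (E d)} (s : Set (E d)) :
    IsTrace s (0 : H1 Ω) (0 : L2b s) := by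
  have g0 : ∀ x, grad (fun _ : E d => (0 : ℂ)) x = 0 := by
    intro x; ext i; simp [grad, partialD]
  refine ⟨fun _ _ => 0, fun _ => contDiff_const, ?_, ?_, ?_⟩
  · refine tendsto_const_nhds.congr fun n => ?_
    refine (?_ : eLpNorm _ 2 (volume.restrict Ω) = 0).symm
    refine (eLpNorm_congr_ae (g := 0) ?_).trans eLpNorm_zero
    filter_upwards [Lp.coeFn_zero ℂ 2 ((volume : Measure (E d)).restrict Ω)] with x hx
    change 0 - (0 : Lp ℂ 2 ((volume : Measure (E d)).restrict Ω)) x = 0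
    rw [hx]; simp
  · refine tendsto_const_nhds.congr fun n => ?_
    refine (?_ : eLpNorm _ 2 (volume.restrict Ω) = 0).symm
    refine (eLpNorm_congr_ae (g := 0) ?_).trans eLpNorm_zero
    filter_upwards [Lp.coeFn_zero (EuclideanSpace ℂ (Fin d)) 2
      ((volume : Measure (E d)).restrict Ω)] with x hx
    change grad (fun _ => 0) x
      - (0 : Lp (EuclideanSpace ℂ (Fin d)) 2 ((volume : Measure (E d)).restrict Ω)) x = 0
    rw [hx, g0]; simp
  · refine tendsto_const_nhds.congr fun n => ?_
    refine (?_ : eLpNorm _ 2 (surf s) = 0).symm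
    refine (eLpNorm_congr_ae (g := 0) ?_).trans eLpNorm_zero
    filter_upwards [Lp.coeFn_zero ℂ 2 (surf s)] with x hx
    rw [hx]; simp

lemma tendsto_eLpNorm_lin {α F : Type*} [MeasurableSpace α] {μ : Measure α}
    [NormedAddCommGroup F] [NormedSpace ℂ F] {a b c : ℕ → α → F} {k : ℂ}
    (hma : ∀ n, AEStronglyMeasurable (a n) μ) (hmb : ∀ n, AEStronglyMeasurable (b n) μ)
    (ha : Tendsto (fun n => eLpNorm (a n) 2 μ) atTop (𝓝 0))
    (hb : Tendsto (fun n => eLpNorm (b n) 2 μ) atTop (𝓝 0))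
    (hc : ∀ n, c n =ᵐ[μ] k • a n + b n) :
    Tendsto (fun n => eLpNorm (c n) 2 μ) atTop (𝓝 0) := by
  have h : Tendsto (fun n => ‖k‖ₑ * eLpNorm (a n) 2 μ + eLpNorm (b n) 2 μ) atTop (𝓝 0) := by
    have := (ENNReal.Tendsto.const_mul ha (Or.inr (enorm_ne_top (x := k)))).add hb
    simpa using this
  refine tendsto_of_tendsto_of_tendsto_of_le_of_le tendsto_const_nhds h (fun _ => zero_le) ?_
  intro n
  change eLpNorm (c n) 2 μ ≤ _
  rw [eLpNorm_congr_ae (hc n)]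
  refine (eLpNorm_add_le ((hma n).const_smul k) (hmb n) (by norm_num)).trans ?_
  rw [eLpNorm_const_smul]

lemma grad_lin {d : ℕ} {φ ψ : E d → ℂ} (hφ : ContDiff ℝ ∞ φ) (hψ : ContDiff ℝ ∞ ψ) (k : ℂ)
    (x : E d) : grad (fun y => k * φ y + ψ y) x = k • grad φ x + grad ψ x := by
  have h1 : DifferentiableAt ℝ φ x := hφ.differentiable (by simp) x
  have h2 : DifferentiableAt ℝ ψ x := hψ.differentiable (by simp) x
  ext i
  simp only [grad, partialD, PiLp.add_apply, PiLp.smul_apply]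
  rw [fderiv_fun_add (h1.const_mul k) h2, fderiv_const_mul h1]
  simp

lemma continuous_grad {d : ℕ} {φ : E d → ℂ} (hφ : ContDiff ℝ ∞ φ) : Continuous (grad φ) := by
  have := hφ.continuous_fderiv (by simp)
  unfold grad partialD
  fun_prop

lemma IsTrace.lin {d : ℕ} {Ω : Set (E d)} {s : Set (E d)} {u v : H1 Ω} {τ σ : L2b s} (k : ℂ)
    (hu : IsTrace s u τ) (hv : IsTrace s v σ) : IsTrace s (k • u + v) (k • τ + σ) := by
  obtain ⟨φ, hφ, a1, a2, a3⟩ := hu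
  obtain ⟨ψ, hψ, b1, b2, b3⟩ := hv
  refine ⟨fun n x => k * φ n x + ψ n x, fun n => (contDiff_const.mul (hφ n)).add (hψ n),
    ?_, ?_, ?_⟩
  · refine tendsto_eLpNorm_lin (k := k) (fun n => ?_) (fun n => ?_) a1 b1 (fun n => ?_)
    · exact (hφ n).continuous.aestronglyMeasurable.sub (Lp.aestronglyMeasurable _)
    · exact (hψ n).continuous.aestronglyMeasurable.sub (Lp.aestronglyMeasurable _)
    · filter_upwards [Lp.coeFn_add (k • H1fn u) (H1fn v), Lp.coeFn_smul k (H1fn u)] with x h1 h2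
      change _ - (k • H1fn u + H1fn v : Lp ℂ 2 _) x = _
      rw [h1, Pi.add_apply, h2]
      simp only [Pi.smul_apply, Pi.add_apply, smul_eq_mul]
      ring
  · refine tendsto_eLpNorm_lin (k := k) (fun n => ?_) (fun n => ?_) a2 b2 (fun n => ?_)
    · exact (continuous_grad (hφ n)).aestronglyMeasurable.sub (Lp.aestronglyMeasurable _)
    · exact (continuous_grad (hψ n)).aestronglyMeasurable.sub (Lp.aestronglyMeasurable _)
    · filter_upwards [Lp.coeFn_add (k • H1grad u) (H1grad v), Lp.coeFn_smul k (H1grad u)]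
        with x h1 h2
      change _ - (k • H1grad u + H1grad v : Lp (EuclideanSpace ℂ (Fin d)) 2 _) x = _
      rw [h1, Pi.add_apply, h2, grad_lin (hφ n) (hψ n)]
      simp only [Pi.smul_apply, Pi.add_apply, smul_sub]
      abel
  · refine tendsto_eLpNorm_lin (k := k) (fun n => ?_) (fun n => ?_) a3 b3 (fun n => ?_)
    · exact (hφ n).continuous.aestronglyMeasurable.sub (Lp.aestronglyMeasurable _)
    · exact (hψ n).continuous.aestronglyMeasurable.sub (Lp.aestronglyMeasurable _)
    · filter_upwards [Lp.coeFn_add (k • τ) σ, Lp.coeFn_smul k τ] with x h1 h2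
      rw [h1, Pi.add_apply, h2]
      simp only [Pi.smul_apply, Pi.add_apply, smul_eq_mul]
      ring

lemma IsTrace.add {d : ℕ} {Ω : Set (E d)} {s : Set (E d)} {u v : H1 Ω} {τ σ : L2b s}
    (hu : IsTrace s u τ) (hv : IsTrace s v σ) : IsTrace s (u + v) (τ + σ) := by
  simpa using hu.lin 1 hv

lemma IsTrace.smul {d : ℕ} {Ω : Set (E d)} {s : Set (E d)} {u : H1 Ω} {τ : L2b s} (k : ℂ)
    (hu : IsTrace s u τ) : IsTrace s (k • u) (k • τ) := by
  simpa using hu.lin k (IsTrace.zero s)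

/-- The range of the trace operator `H¹(Ω) → L²(∂Ω)`. -/
def traceSpace {d : ℕ} (Ω : Set (E d)) : Submodule ℂ (L2b Ω) where
  carrier := {f | ∃ u : H1 Ω, IsTrace Ω u f}
  zero_mem' := ⟨0, IsTrace.zero Ω⟩
  add_mem' := by
    rintro f g ⟨u, hu⟩ ⟨v, hv⟩
    exact ⟨u + v, hu.add hv⟩
  smul_mem' := by
    rintro k f ⟨u, hu⟩
    exact ⟨k • u, hu.smul k⟩

/-- The trace space `H^{1/2}(∂Ω)`: the traces on `∂Ω` of functions in `H¹(Ω)`, normed (below) by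
`‖f‖ = inf { ‖u‖_{H¹(Ω)} : u|_{∂Ω} = f }`. -/
def HHalf {d : ℕ} (Ω : Set (E d)) : Type := traceSpace Ω

instance {d : ℕ} (Ω : Set (E d)) : AddCommGroup (HHalf Ω) :=
  inferInstanceAs (AddCommGroup (traceSpace Ω))

instance {d : ℕ} (Ω : Set (E d)) : Module ℂ (HHalf Ω) :=
  inferInstanceAs (Module ℂ (traceSpace Ω))

/-- The inclusion `H^{1/2}(∂Ω) ⊆ L²(∂Ω)`. -/
def HHalf.toL2 {d : ℕ} {Ω : Set (E d)} : HHalf Ω →ₗ[ℂ] L2b Ω := (traceSpace Ω).subtype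

instance {d : ℕ} (Ω : Set (E d)) : Norm (HHalf Ω) :=
  ⟨fun f => sInf {r | ∃ u : H1 Ω, IsTrace Ω u f.toL2 ∧ r = ‖u‖}⟩

lemma HHalf.norm_le {d : ℕ} {Ω : Set (E d)} {f : HHalf Ω} {u : H1 Ω}
    (h : IsTrace Ω u f.toL2) : ‖f‖ ≤ ‖u‖ :=
  csInf_le ⟨0, by rintro r ⟨v, -, rfl⟩; exact norm_nonneg v⟩ ⟨u, h, rfl⟩

lemma HHalf.exists_lift {d : ℕ} {Ω : Set (E d)} (f : HHalf Ω) {ε : ℝ} (hε : 0 < ε) :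
    ∃ u : H1 Ω, IsTrace Ω u f.toL2 ∧ ‖u‖ < ‖f‖ + ε := by
  obtain ⟨u, hu⟩ := f.2
  obtain ⟨r, ⟨v, hv, rfl⟩, hr⟩ := exists_lt_of_csInf_lt
    (s := {r | ∃ u : H1 Ω, IsTrace Ω u f.toL2 ∧ r = ‖u‖}) ⟨_, u, hu, rfl⟩
    (lt_add_of_pos_right ‖f‖ hε)
  exact ⟨v, hv, hr⟩

lemma HHalf.norm_smul_le' {d : ℕ} {Ω : Set (E d)} (c : ℂ) (f : HHalf Ω) :
    ‖c • f‖ ≤ ‖c‖ * ‖f‖ := by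
  refine le_of_forall_pos_le_add fun ε hε => ?_
  obtain ⟨u, hu, hn⟩ := f.exists_lift (ε := ε / (‖c‖ + 1)) (by positivity)
  have h1 : ‖c • f‖ ≤ ‖c • u‖ := HHalf.norm_le (by rw [map_smul]; exact hu.smul c)
  have h0 : ‖c • u‖ = ‖c‖ * ‖u‖ := norm_smul c u
  rw [h0] at h1
  have h2 : ‖c‖ * (ε / (‖c‖ + 1)) ≤ ε := by
    rw [mul_div_assoc', div_le_iff₀ (by positivity)]
    nlinarith [norm_nonneg c]
  have h3 := mul_le_mul_of_nonneg_left hn.le (norm_nonneg c)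
  linarith

lemma HHalf.core {d : ℕ} (Ω : Set (E d)) : SeminormedSpace.Core ℂ (HHalf Ω) where
  norm_nonneg f := Real.sInf_nonneg (by rintro r ⟨v, -, rfl⟩; exact norm_nonneg v)
  norm_smul c f := by
    refine le_antisymm (HHalf.norm_smul_le' c f) ?_
    by_cases hc : c = 0
    · subst hc
      rw [norm_zero, zero_mul]
      exact Real.sInf_nonneg (by rintro r ⟨v, -, rfl⟩; exact norm_nonneg v)
    · have h := HHalf.norm_smul_le' c⁻¹ (c • f)
      rw [smul_smul, inv_mul_cancel₀ hc, one_smul, norm_inv] at h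
      have hp : 0 < ‖c‖ := norm_pos_iff.2 hc
      calc ‖c‖ * ‖f‖ ≤ ‖c‖ * (‖c‖⁻¹ * ‖c • f‖) := mul_le_mul_of_nonneg_left h hp.le
        _ = ‖c • f‖ := by field_simp
  norm_triangle f g := by
    refine le_of_forall_pos_le_add fun ε hε => ?_
    obtain ⟨u, hu, hn⟩ := f.exists_lift (half_pos hε)
    obtain ⟨v, hv, hm⟩ := g.exists_lift (half_pos hε)
    have h1 : ‖f + g‖ ≤ ‖u + v‖ := HHalf.norm_le (by rw [map_add]; exact hu.add hv)
    have := norm_add_le u v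
    linarith

instance {d : ℕ} (Ω : Set (E d)) : SeminormedAddCommGroup (HHalf Ω) :=
  SeminormedAddCommGroup.ofCore (HHalf.core Ω)

instance {d : ℕ} (Ω : Set (E d)) : NormedSpace ℂ (HHalf Ω) where
  norm_smul_le c f := HHalf.norm_smul_le' c f

/-- `H^{-1/2}(∂Ω)`: the bounded conjugate-linear functionals `ℓ` on `H^{1/2}(∂Ω)`, where `ℓ φ`
stands for `∫_{∂Ω} ℓ φ̄ ds`. -/
abbrev HMinusHalf {d : ℕ} (Ω : Set (E d)) : Type := HHalf Ω →L⋆[ℂ] ℂ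

/-- `∫_A ∇u · ∇φ̄ dx`. -/
def dirichlet {d : ℕ} {Ω : Set (E d)} (A : Set (E d)) (u φ : H1 Ω) : ℂ :=
  ∫ x in A, inner ℂ (H1grad φ x) (H1grad u x)

/-- `u ∈ H¹(Ω)` has trace zero on `∂Ω`, that is, `u ∈ H¹₀(Ω)`. -/
def IsH10 {d : ℕ} {Ω : Set (E d)} (u : H1 Ω) : Prop := IsTrace Ω u 0

/-- `-Δu = 0` in the open set `A ⊆ Ω`, in the sense of distributions. -/
def IsHarmonicIn {d : ℕ} {Ω : Set (E d)} (A : Set (E d)) (u : H1 Ω) : Prop :=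
  ∀ φ : E d → ℂ, ContDiff ℝ ∞ φ → HasCompactSupport φ → tsupport φ ⊆ A →
    ∫ x in Ω, inner ℂ (grad φ x) (H1grad u x) = 0

/-- The pairing of the outer normal derivative `∂_ν u⁺` on `∂D` (taken from `Ω \ D̄`, `ν` pointing
out of `D`) with the trace of `φ ∈ H¹₀(Ω)`, for `u` harmonic in `Ω \ D̄`; given by
Green's first identity in `Ω \ D̄`. -/
def conormalPlus {d : ℕ} {Ω : Set (E d)} (D : Set (E d)) (u φ : H1 Ω) : ℂ :=
  - dirichlet (Ω \ closure D) u φ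

/-- The pairing of the inner normal derivative `∂_ν u⁻` on `∂D` (taken from `D`) with the trace of
`φ ∈ H¹₀(Ω)`, for `u` harmonic in `D`; given by Green's first identity in `D`. -/
def conormalMinus {d : ℕ} {Ω : Set (E d)} (D : Set (E d)) (u φ : H1 Ω) : ℂ :=
  dirichlet D u φ

/-- `-Δu = 0` in `Ω \ ∂D` and `[[∂_ν u]] = ∂_ν u⁺ - ∂_ν u⁻ = q` on `∂D`, where both sides of the
jump condition are paired with the traces on `∂D` of functions in `H¹₀(Ω)`. -/
def SolvesJump {d : ℕ} {Ω : Set (E d)} (D : Set (E d)) (u : H1 Ω) (q : E d → ℂ) : Prop :=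
  IsHarmonicIn (Ω \ frontier D) u ∧
    ∀ φ : H1 Ω, IsH10 φ → ∀ ψ : L2b D, IsTrace D φ ψ →
      conormalPlus D u φ - conormalMinus D u φ = ∫ x, q x * starRingEnd ℂ (ψ x) ∂(surf D)

/-- `u` is the potential in the defective material: `-Δu = 0` in `Ω \ ∂D`, `u = f` on `∂Ω` and
`[[∂_ν u]] = γ u` on `∂D`. -/
def IsPotential {d : ℕ} (Ω D : Set (E d)) (γ : E d → ℝ) (f : HHalf Ω) (u : H1 Ω) : Prop :=
  IsTrace Ω u f.toL2 ∧
    ∃ τ : L2b D, IsTrace D u τ ∧ SolvesJump D u (fun x => (γ x : ℂ) * τ x)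

/-- `u` is the harmonic lifting of `f`: `-Δu = 0` in `Ω` (weakly, tested with `H¹₀(Ω)`) and `u = f`
on `∂Ω`. -/
def IsHarmonicLift {d : ℕ} (Ω : Set (E d)) (f : HHalf Ω) (u : H1 Ω) : Prop :=
  IsTrace Ω u f.toL2 ∧ ∀ φ : H1 Ω, IsH10 φ → dirichlet Ω u φ = 0

/-- `w ∈ H¹₀(Ω)` solves `-Δw = 0` in `Ω \ ∂D`, `[[∂_ν w]] = γ h` on `∂D`. -/
def IsSourceSol {d : ℕ} (Ω D : Set (E d)) (γ : E d → ℝ) (h : L2b D) (w : H1 Ω) : Prop :=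
  IsH10 w ∧ SolvesJump D w (fun x => (γ x : ℂ) * h x)

/-- `v ∈ H¹₀(Ω)` solves `-Δv = 0` in `Ω \ ∂D`, `[[∂_ν v]] = γ v + g` on `∂D`. -/
def IsAdjointSol {d : ℕ} (Ω D : Set (E d)) (γ : E d → ℝ) (g : L2b D) (v : H1 Ω) : Prop :=
  IsH10 v ∧
    ∃ τ : L2b D, IsTrace D v τ ∧ SolvesJump D v (fun x => (γ x : ℂ) * τ x + g x)

/-- `ℓ = ∂_ν u` on `∂Ω`, for `u ∈ H¹(Ω)` harmonic in `Ω \ K`, where `K ⊆ Ω` is compact: by Green's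
first identity, `⟨ℓ, φ⟩ = ∫_Ω ∇u · ∇Φ̄ dx` for every lifting `Φ ∈ H¹(Ω)` of `φ ∈ H^{1/2}(∂Ω)` that
vanishes near `K`. -/
def IsNeumannTrace {d : ℕ} {Ω : Set (E d)} (K : Set (E d)) (u : H1 Ω) (ℓ : HMinusHalf Ω) : Prop :=
  ∀ (φ : HHalf Ω) (Φ : H1 Ω), IsTrace Ω Φ φ.toL2 →
    (∃ V : Set (E d), IsOpen V ∧ K ⊆ V ∧ ∀ᵐ x ∂(volume.restrict (Ω ∩ V)), H1fn Φ x = 0) →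
    ℓ φ = dirichlet Ω u Φ

/-- `Λ` is the Dirichlet-to-Neumann map `f ↦ ∂_ν u|_{∂Ω}` of the defective material. -/
def IsDtN {d : ℕ} (Ω D : Set (E d)) (γ : E d → ℝ) (Λ : HHalf Ω →L[ℂ] HMinusHalf Ω) : Prop :=
  ∀ f ℓ, Λ f = ℓ ↔ ∃ u : H1 Ω, IsPotential Ω D γ f u ∧ IsNeumannTrace (closure D) u ℓ

/-- `Λ₀` is the Dirichlet-to-Neumann map `f ↦ ∂_ν u₀|_{∂Ω}` of the healthy material. -/
def IsDtN₀ {d : ℕ} (Ω : Set (E d)) (Λ₀ : HHalf Ω →L[ℂ] HMinusHalf Ω) : Prop :=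
  ∀ f ℓ, Λ₀ f = ℓ ↔ ∃ u₀ : H1 Ω, IsHarmonicLift Ω f u₀ ∧ IsNeumannTrace ∅ u₀ ℓ

/-- `S` is the operator `f ↦ u|_{∂D}`. -/
def IsOpS {d : ℕ} (Ω D : Set (E d)) (γ : E d → ℝ) (S : HHalf Ω →L[ℂ] L2b D) : Prop :=
  ∀ f τ, S f = τ ↔ ∃ u : H1 Ω, IsPotential Ω D γ f u ∧ IsTrace D u τ

/-- `T` is the operator `h ↦ γ (h - w|_{∂D})`. -/
def IsOpT {d : ℕ} (Ω D : Set (E d)) (γ : E d → ℝ) (T : L2b D →L[ℂ] L2b D) : Prop :=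
  ∀ h k, T h = k ↔ ∃ (w : H1 Ω) (τ : L2b D), IsSourceSol Ω D γ h w ∧ IsTrace D w τ ∧
    ∀ᵐ x ∂(surf D), k x = (γ x : ℂ) * (h x - τ x)

/-- The adjoint `S* : L²(∂D) → H^{-1/2}(∂Ω)` of a bounded operator `S : H^{1/2}(∂Ω) → L²(∂D)`. -/
def adj {d : ℕ} {Ω D : Set (E d)} (S : HHalf Ω →L[ℂ] L2b D) : L2b D →L[ℂ] HMinusHalf Ω :=
  ((ContinuousLinearMap.compSL (HHalf Ω) (L2b D) ℂ (RingHom.id ℂ) (starRingEnd ℂ)).flip S).comp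
    (innerSLFlip ℂ)

/-- `⟨S* g, f⟩ = ∫_{∂D} g \overline{S f} ds`. -/
lemma adj_apply {d : ℕ} {Ω D : Set (E d)} (S : HHalf Ω →L[ℂ] L2b D) (g : L2b D) (f : HHalf Ω) :
    adj S g f = inner ℂ (S f) g := rfl

end

end EIT

open EIT

/-!
The four boundary value problems are solved variationally in the Hilbert space `TrSpace Ω D`, the
graph of the trace operator `u ↦ u|_{∂D}` on the functions in `H¹(Ω)` that are limits of smooth
functions. Since `∂D` is a null set, the jump condition `[[∂_ν u]] = q` together with harmonicity off
`∂D` says exactly that `∫_Ω ∇u · ∇φ̄ = -∫_{∂D} q φ̄` for all `φ ∈ H¹₀(Ω)`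
(`Admissible.solvesJump_iff`). So the problems are linear equations for the two forms
`∫_Ω ∇u · ∇φ̄` and `∫_Ω ∇u · ∇φ̄ + ∫_{∂D} γ u φ̄`, and existence and uniqueness follow from
Lax–Milgram on the subspace `TrSpace₀ Ω D` of functions vanishing on `∂Ω`, since `γ ≥ 0`.

Two analytic facts carry this.
* The trace inequality `‖φ‖_{L²(∂D)} ≤ C ‖φ‖_{H¹(Ω)}` for smooth `φ` (`traceIneq_frontier`): over a
  local graph, the value at a boundary point is compared with the values on a short segment below it
  and averaged. It makes traces on `∂D` exist, be unique and bounded, and, for `φ = 1`, shows that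
  `∂D` has finite surface measure, hence Lebesgue measure zero.
* The Friedrichs inequality `‖φ‖_{L²(Ω)} ≤ C (‖∇φ‖_{L²(Ω)} + ‖φ‖_{L²(∂Ω)})` (`friedrichs`). It holds
  on every bounded open set: integrate `∇φ` from `x` to the point where a line in a fixed direction
  first leaves `Ω`; the exit points have a distribution dominated by surface measure, because the
  projection along the direction does not increase Hausdorff measure. It gives coercivity on
  `H¹₀(Ω)`.

The Neumann trace on `∂Ω` of a solution is the residual functional `Φ ↦ a(u, Φ)`, which only depends
on the boundary values of `Φ` and for `Φ` vanishing near `D` reduces to `∫_Ω ∇u · ∇Φ̄`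
(`Admissible.isNeumannTrace_of`). In the factorization let `u` and `u₀` be the potential and the
harmonic lifting of `f`, and `v` the potential of `φ`. Then `u - u₀` is the solution `w` with source
`S f` (`sub_eq_source_solution`), so `T S f = γ u₀`, and testing the equation for `v` with `u - u₀`
gives `⟪(Λ - Λ₀) f, φ⟫ = ∫_{∂D} γ u₀ v̄ = ∫_{∂D} (T S f) conj (S φ)` (`formOp_sub_eq`).
-/

namespace EIT

/-! ### Integration along a direction and Hausdorff measure -/

lemma lintegral_sq_le {α : Type*} [MeasurableSpace α] (μ : Measure α) {f : α → ℝ≥0∞}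
    (hf : AEMeasurable f μ) : (∫⁻ x, f x ∂μ) ^ 2 ≤ μ univ * ∫⁻ x, f x ^ 2 ∂μ := by
  have h := ENNReal.lintegral_mul_le_Lp_mul_Lq μ Real.HolderConjugate.two_two hf
    (aemeasurable_const (b := (1 : ℝ≥0∞)))
  simp only [Pi.mul_apply, mul_one, ENNReal.one_rpow, lintegral_const, one_mul] at h
  calc (∫⁻ x, f x ∂μ) ^ 2
      ≤ ((∫⁻ x, f x ^ (2 : ℝ) ∂μ) ^ (1 / 2 : ℝ) * μ univ ^ (1 / 2 : ℝ)) ^ 2 := by gcongr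
    _ = μ univ * ∫⁻ x, f x ^ 2 ∂μ := by
      rw [mul_pow, ← ENNReal.rpow_natCast, ← ENNReal.rpow_natCast, ← ENNReal.rpow_mul,
        ← ENNReal.rpow_mul]
      norm_num
      rw [mul_comm]

lemma ennreal_add_sq_le (a b : ℝ≥0∞) : (a + b) ^ 2 ≤ 2 * a ^ 2 + 2 * b ^ 2 := by
  have h := ENNReal.rpow_add_le_mul_rpow_add_rpow a b (p := 2) (by norm_num)
  norm_num at h
  rw [← mul_add]
  exact h

variable {d : ℕ}

lemma norm_fderiv_le_grad {φ : E d → ℂ} (x : E d) {e : E d} (he : ‖e‖ = 1) :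
    ‖fderiv ℝ φ x e‖ ≤ ‖grad φ x‖ := by
  have h1 : fderiv ℝ φ x e = ∑ i, (e i) • partialD i φ x := by
    conv_lhs => rw [← (EuclideanSpace.basisFun (Fin d) ℝ).sum_repr e]
    simp [partialD]
  have h2 : fderiv ℝ φ x e
      = inner ℂ (WithLp.toLp 2 (fun i => (e i : ℂ)) : EuclideanSpace ℂ (Fin d)) (grad φ x) := by
    rw [h1, PiLp.inner_apply]
    refine Finset.sum_congr rfl fun i _ => ?_
    simp [grad, mul_comm]
  have h3 : ‖(WithLp.toLp 2 (fun i => (e i : ℂ)) : EuclideanSpace ℂ (Fin d))‖ = 1 := by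
    rw [← he, EuclideanSpace.norm_eq, EuclideanSpace.norm_eq]
    simp
  rw [h2]
  refine (norm_inner_le_norm _ _).trans ?_
  rw [h3, one_mul]

/-- The fundamental theorem of calculus along a segment, squared. -/
lemma enorm_sq_le_segment {φ : E d → ℂ} (hφ : ContDiff ℝ ∞ φ) (x : E d) {e : E d} (he : ‖e‖ = 1)
    {t L : ℝ} (ht : 0 ≤ t) (htL : t ≤ L) :
    ‖φ x‖ₑ ^ 2 ≤ 2 * ‖φ (x + t • e)‖ₑ ^ 2
      + 2 * (ENNReal.ofReal L * ∫⁻ s in Ioo 0 t, ‖grad φ (x + s • e)‖ₑ ^ 2) := by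
  have hd : Differentiable ℝ φ := hφ.differentiable (by simp)
  have hc : Continuous (fderiv ℝ φ) := hφ.continuous_fderiv (by simp)
  have hline : ∀ s : ℝ, HasDerivAt (fun s : ℝ => φ (x + s • e)) (fderiv ℝ φ (x + s • e) e) s := by
    intro s
    have h1 : HasDerivAt (fun s : ℝ => x + s • e) e s := by
      simpa using ((hasDerivAt_id s).smul_const e).const_add x
    exact (hd (x + s • e)).hasFDerivAt.comp_hasDerivAt s h1
  have hcs : Continuous fun s : ℝ => fderiv ℝ φ (x + s • e) e := by fun_prop
  have ftc := intervalIntegral.integral_eq_sub_of_hasDerivAt (fun s _ => hline s)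
    (hcs.intervalIntegrable 0 t)
  have hg : Measurable fun s : ℝ => ‖grad φ (x + s • e)‖ₑ :=
    ((continuous_grad hφ).comp (by fun_prop : Continuous fun s : ℝ => x + s • e)).enorm.measurable
  have h1 : ‖φ x‖ₑ ≤ ‖φ (x + t • e)‖ₑ + ∫⁻ s in Ioo 0 t, ‖grad φ (x + s • e)‖ₑ := by
    have e1 : φ x = φ (x + t • e) - ∫ s in (0)..t, fderiv ℝ φ (x + s • e) e := by
      rw [ftc]; simp
    rw [e1]
    refine (enorm_sub_le).trans ?_
    gcongr
    rw [intervalIntegral.integral_of_le ht, restrict_Ioo_eq_restrict_Ioc]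
    refine (enorm_integral_le_lintegral_enorm _).trans (lintegral_mono fun s => ?_)
    exact enorm_le_iff_norm_le.2 (norm_fderiv_le_grad _ he)
  refine (pow_le_pow_left' h1 2).trans ((ennreal_add_sq_le _ _).trans ?_)
  gcongr
  refine (lintegral_sq_le _ hg.aemeasurable).trans ?_
  gcongr
  simp only [MeasurableSet.univ, Measure.restrict_apply, univ_inter, Real.volume_Ioo, sub_zero]
  exact ENNReal.ofReal_le_ofReal htL

/-- Lebesgue measure on `ℝ^d` splits as the product of the measures on a line and on the orthogonal
hyperplane. -/
lemma measurePreserving_line_add {e : E d} (he : ‖e‖ = 1) :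
    MeasurePreserving (fun p : ℝ × (Submodule.span ℝ {e})ᗮ => p.1 • e + (p.2 : E d))
      (volume.prod volume) volume := by
  have h1 := ((Submodule.span ℝ {e}).measurePreserving_measurableEquivProd (0 : E d)).symm
  rw [InnerProductSpace.euclideanHausdorffMeasure_eq_volume] at h1
  have h2 := (LinearIsometryEquiv.toSpanUnitSingleton (𝕜 := ℝ) e he).measurePreserving
  have h3 := h1.comp (h2.prod (MeasurePreserving.id (volume : Measure (Submodule.span ℝ {e})ᗮ)))
  have h4 : (fun p : ℝ × (Submodule.span ℝ {e})ᗮ => p.1 • e + (p.2 : E d))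
      = ((Submodule.span ℝ {e}).measurableEquivProd (0 : E d)).symm ∘
        Prod.map (LinearIsometryEquiv.toSpanUnitSingleton e he) id := by
    ext1 p
    simp
  rw [h4]
  exact h3

lemma hausdorff_hyperplane {e : E d} (he : ‖e‖ = 1) :
    (μHE[d - 1] : Measure (Submodule.span ℝ {e})ᗮ) = volume := by
  have h0 : e ≠ 0 := by rintro rfl; simp at he
  have h1 := (Submodule.span ℝ {e}).finrank_add_finrank_orthogonal
  rw [finrank_span_singleton h0, finrank_euclideanSpace_fin] at h1
  have h2 : d - 1 = Module.finrank ℝ (Submodule.span ℝ {e})ᗮ := by omega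
  rw [h2, InnerProductSpace.euclideanHausdorffMeasure_eq_volume]

lemma euclideanHausdorff_image_le {X Y : Type*} [EMetricSpace X] [MeasurableSpace X] [BorelSpace X]
    [EMetricSpace Y] [MeasurableSpace Y] [BorelSpace Y] {f : X → Y} {K : NNReal} {s : Set X}
    (h : LipschitzOnWith K f s) (n : ℕ) :
    (μHE[n] : Measure Y) (f '' s) ≤ (K : ℝ≥0∞) ^ n * (μHE[n] : Measure X) s := by
  simp only [Measure.euclideanHausdorffMeasure_def, Measure.smul_apply, ENNReal.smul_def,
    smul_eq_mul]
  have := h.hausdorffMeasure_image_le (d := n) (by positivity)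
  rw [ENNReal.rpow_natCast] at this
  calc _ ≤ _ := mul_le_mul_right this _
    _ = _ := by ring

/-! ### The Friedrichs inequality -/

/-- The time at which the half line from `x` in direction `e` first leaves `Ω`. -/
noncomputable def exitTime (Ω : Set (E d)) (e x : E d) : ℝ := sInf {t | 0 ≤ t ∧ x + t • e ∉ Ω}

lemma exitTime_nonneg (Ω : Set (E d)) (e x : E d) : 0 ≤ exitTime Ω e x :=
  Real.sInf_nonneg fun _ h => h.1

lemma lineBounded {Ω : Set (E d)} {R : ℝ} (hR : Ω ⊆ Metric.closedBall 0 R) {e : E d}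
    (he : ‖e‖ = 1) {x y : E d} (hx : x ∈ Ω) (hy : y ∈ Ω) {t : ℝ} (h : y = x + t • e) :
    |t| ≤ 2 * R := by
  have h1 : ‖y - x‖ = |t| := by rw [h]; simp [norm_smul, he]
  have h2 := hR hx
  have h3 := hR hy
  rw [mem_closedBall_zero_iff] at h2 h3
  linarith [norm_sub_le y x]

lemma exists_notMem_line {Ω : Set (E d)} (hb : Bornology.IsBounded Ω) {e : E d} (he : ‖e‖ = 1)
    (x : E d) : ∃ t : ℝ, 0 ≤ t ∧ x + t • e ∉ Ω := by
  obtain ⟨R, hR⟩ := hb.subset_closedBall 0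
  refine ⟨|R| + ‖x‖ + 1, by positivity, fun h => ?_⟩
  have h1 := hR h
  rw [mem_closedBall_zero_iff] at h1
  have h2 : ‖(|R| + ‖x‖ + 1) • e‖ = |R| + ‖x‖ + 1 := by
    rw [norm_smul, he, mul_one, Real.norm_of_nonneg (by positivity)]
  have h3 := norm_sub_le (x + (|R| + ‖x‖ + 1) • e) x
  rw [add_sub_cancel_left, h2] at h3
  linarith [le_abs_self R]

lemma exitTime_mem {Ω : Set (E d)} (ho : IsOpen Ω) (hb : Bornology.IsBounded Ω) {e : E d}
    (he : ‖e‖ = 1) (x : E d) : x + exitTime Ω e x • e ∉ Ω := by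
  have hcl : IsClosed {t : ℝ | 0 ≤ t ∧ x + t • e ∉ Ω} :=
    isClosed_Ici.inter (ho.isClosed_compl.preimage (by fun_prop : Continuous fun t : ℝ => x + t • e))
  exact (hcl.csInf_mem (exists_notMem_line hb he x) ⟨0, fun _ h => h.1⟩).2

lemma mem_of_lt_exitTime {Ω : Set (E d)} {e x : E d} {t : ℝ} (h0 : 0 ≤ t)
    (ht : t < exitTime Ω e x) : x + t • e ∈ Ω := by
  by_contra h
  exact absurd (csInf_le ⟨0, fun _ h => h.1⟩ (show t ∈ {t | 0 ≤ t ∧ x + t • e ∉ Ω} from ⟨h0, h⟩))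
    (not_le.2 ht)

lemma measurable_exitTime {Ω : Set (E d)} (ho : IsOpen Ω) (hb : Bornology.IsBounded Ω) {e : E d}
    (he : ‖e‖ = 1) : Measurable (exitTime Ω e) := by
  refine measurable_of_Ioi fun a => IsOpen.measurableSet ?_
  by_cases ha : a < 0
  · convert isOpen_univ
    ext x
    simpa using ha.trans_le (exitTime_nonneg Ω e x)
  push Not at ha
  have : exitTime Ω e ⁻¹' Ioi a = {x | ∀ s ∈ Icc 0 a, x + s • e ∈ Ω} := by
    ext x
    refine ⟨fun h s hs => mem_of_lt_exitTime hs.1 (hs.2.trans_lt h), fun h => ?_⟩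
    by_contra h'
    exact exitTime_mem ho hb he x (h _ ⟨exitTime_nonneg Ω e x, not_lt.1 h'⟩)
  rw [this, isOpen_iff_eventually]
  intro x hx
  refine isCompact_Icc.eventually_forall_of_forall_eventually fun s hs => ?_
  exact (by fun_prop : Continuous fun z : E d × ℝ => z.1 + z.2 • e).continuousAt.eventually
    (ho.eventually_mem (hx s hs))

lemma exitPoint_mem_frontier {Ω : Set (E d)} (ho : IsOpen Ω) (hb : Bornology.IsBounded Ω)
    {e : E d} (he : ‖e‖ = 1) {x : E d} (hx : x ∈ Ω) : x + exitTime Ω e x • e ∈ frontier Ω := by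
  rw [ho.frontier_eq]
  refine ⟨?_, exitTime_mem ho hb he x⟩
  have hpos : 0 < exitTime Ω e x := by
    refine lt_of_le_of_ne (exitTime_nonneg Ω e x) fun h => exitTime_mem ho hb he x ?_
    rw [← h]; simpa using hx
  have h1 : exitTime Ω e x ∈ closure (Ico 0 (exitTime Ω e x)) := by
    rw [closure_Ico hpos.ne]; exact ⟨hpos.le, le_rfl⟩
  have h2 : MapsTo (fun t : ℝ => x + t • e) (Ico 0 (exitTime Ω e x)) Ω :=
    fun t ht => mem_of_lt_exitTime ht.1 ht.2
  exact h2.closure (by fun_prop) h1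

lemma exitTime_le {Ω : Set (E d)} {R : ℝ} (hR : Ω ⊆ Metric.closedBall 0 R) {e : E d}
    (he : ‖e‖ = 1) {x : E d} (hx : x ∈ Ω) : exitTime Ω e x ≤ 2 * R := by
  have hR0 : 0 ≤ R := by
    have := hR hx; rw [mem_closedBall_zero_iff] at this; exact (norm_nonneg x).trans this
  by_contra h
  push Not at h
  obtain ⟨s, h1, h2⟩ := exists_between h
  have := lineBounded hR he hx (mem_of_lt_exitTime (by linarith) h2) rfl
  rw [abs_of_nonneg (by linarith)] at this
  linarith

/-- The push-forward of Lebesgue measure on `Ω` under the first exit point is dominated by surface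
measure, because the exit point lies on the line through `x` and the orthogonal projection along
this line does not increase Hausdorff measure. -/
lemma lintegral_exitPoint_le {Ω : Set (E d)} (ho : IsOpen Ω) {R : ℝ}
    (hR : Ω ⊆ Metric.closedBall 0 R) {e : E d} (he : ‖e‖ = 1) {f : E d → ℝ≥0∞} (hf : Measurable f) :
    ∫⁻ x in Ω, f (x + exitTime Ω e x • e) ≤ ENNReal.ofReal (2 * R) * ∫⁻ x, f x ∂(surf Ω) := by
  have hb : Bornology.IsBounded Ω := Metric.isBounded_closedBall.subset hR
  set b : E d → E d := fun x => x + exitTime Ω e x • e with hbdef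
  have hbm : Measurable b :=
    measurable_id.add ((measurable_exitTime ho hb he).smul measurable_const)
  have key : Measure.map b (volume.restrict Ω) ≤ ENNReal.ofReal (2 * R) • surf Ω := by
    refine Measure.le_intro fun A hA _ => ?_
    rw [Measure.map_apply hbm hA, Measure.restrict_apply (hbm hA), Measure.smul_apply, surf,
      Measure.restrict_apply hA, smul_eq_mul]
    set K := (Submodule.span ℝ {e})ᗮ
    set P : E d → K := fun x => K.orthogonalProjectionOnto x with hP
    set B := toMeasurable volume (P '' (A ∩ frontier Ω))
    have hBm : MeasurableSet B := measurableSet_toMeasurable _ _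
    have hPL : LipschitzWith 1 P := by
      refine LipschitzWith.of_dist_le_mul fun x y => ?_
      rw [NNReal.coe_one, one_mul, dist_eq_norm, dist_eq_norm, hP]
      dsimp only
      rw [← map_sub]
      exact K.norm_orthogonalProjectionOnto_apply_le _
    have hB : volume B ≤ μHE[d - 1] (A ∩ frontier Ω) := by
      rw [measure_toMeasurable, ← hausdorff_hyperplane he]
      simpa using euclideanHausdorff_image_le (hPL.lipschitzOnWith (s := A ∩ frontier Ω)) (d - 1)
    have hPe : P e = 0 := by
      rw [hP]
      dsimp only
      rw [Submodule.orthogonalProjectionOnto_eq_zero_iff, Submodule.orthogonal_orthogonal]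
      exact Submodule.mem_span_singleton_self e
    have hm := measurePreserving_line_add he
    have hsub : b ⁻¹' A ∩ Ω ⊆ {x | inner ℝ e x ∈ Icc (-R) R ∧ P x ∈ B} := by
      rintro x ⟨hxA, hxΩ⟩
      refine ⟨?_, subset_toMeasurable _ _ ⟨b x, ⟨hxA, exitPoint_mem_frontier ho hb he hxΩ⟩, ?_⟩⟩
      · have h1 := hR hxΩ
        rw [mem_closedBall_zero_iff] at h1
        have h2 := abs_real_inner_le_norm e x
        rw [he, one_mul] at h2
        exact abs_le.1 (h2.trans h1)
      · simp only [hbdef, hP] at hPe ⊢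
        rw [map_add, map_smul, hPe, smul_zero, add_zero]
    have hset : MeasurableSet {x | inner ℝ e x ∈ Icc (-R) R ∧ P x ∈ B} :=
      ((by fun_prop : Continuous fun x : E d => inner ℝ e x).measurable measurableSet_Icc).inter
        (hPL.continuous.measurable hBm)
    refine (measure_mono hsub).trans ?_
    rw [← hm.measure_preimage hset.nullMeasurableSet]
    have hpre : (fun p : ℝ × K => p.1 • e + (p.2 : E d)) ⁻¹'
        {x | inner ℝ e x ∈ Icc (-R) R ∧ P x ∈ B} = Icc (-R) R ×ˢ B := by
      ext ⟨t, y⟩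
      have h1 : inner ℝ e (t • e + (y : E d)) = t := by
        have : inner ℝ e (y : E d) = 0 :=
          Submodule.inner_right_of_mem_orthogonal (Submodule.mem_span_singleton_self e) y.2
        rw [inner_add_right, inner_smul_right, this, real_inner_self_eq_norm_sq, he]; simp
      have h2 : P (t • e + (y : E d)) = y := by
        simp only [hP] at hPe ⊢
        rw [map_add, map_smul, hPe, smul_zero, zero_add,
          Submodule.orthogonalProjectionOnto_mem_subspace_eq_self]
      simp only [mem_preimage, mem_ofPred_eq, h1, h2, mem_prod]
    rw [hpre, Measure.prod_prod, Real.volume_Icc]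
    gcongr
    apply le_of_eq; ring
  calc ∫⁻ x in Ω, f (b x) = ∫⁻ y, f y ∂(Measure.map b (volume.restrict Ω)) :=
        (lintegral_map hf hbm).symm
    _ ≤ ∫⁻ y, f y ∂(ENNReal.ofReal (2 * R) • surf Ω) := lintegral_mono' key le_rfl
    _ = _ := by rw [lintegral_smul_measure, smul_eq_mul]

/-- The Friedrichs inequality: on a bounded open set, the `L²` norm of a smooth function is
controlled by that of its gradient and that of its boundary values. -/
lemma friedrichs {Ω : Set (E d)} (hd : 0 < d) (ho : IsOpen Ω) (hb : Bornology.IsBounded Ω) :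
    ∃ C : ℝ≥0∞, C ≠ ⊤ ∧ ∀ φ : E d → ℂ, ContDiff ℝ ∞ φ →
      ∫⁻ x in Ω, ‖φ x‖ₑ ^ 2
        ≤ C * ((∫⁻ x in Ω, ‖grad φ x‖ₑ ^ 2) + ∫⁻ x, ‖φ x‖ₑ ^ 2 ∂(surf Ω)) := by
  obtain ⟨R, hR⟩ := hb.subset_closedBall 0
  set e : E d := EuclideanSpace.single ⟨0, hd⟩ 1
  have he : ‖e‖ = 1 := by simp [e]
  set L := ENNReal.ofReal (2 * R)
  refine ⟨2 * (L * L) + 2 * L, by finiteness, fun φ hφ => ?_⟩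
  set h : E d → ℝ≥0∞ := Ω.indicator fun x => ‖grad φ x‖ₑ ^ 2 with hh
  have hgm : Measurable fun x => ‖grad φ x‖ₑ ^ 2 := (continuous_grad hφ).enorm.measurable.pow_const 2
  have hhm : Measurable h := hgm.indicator ho.measurableSet
  have hφm : Measurable fun x => ‖φ x‖ₑ ^ 2 := hφ.continuous.enorm.measurable.pow_const 2
  have hem := measurable_exitTime ho hb he
  have hpt : ∀ x ∈ Ω, ‖φ x‖ₑ ^ 2 ≤ 2 * ‖φ (x + exitTime Ω e x • e)‖ₑ ^ 2
      + 2 * L * ∫⁻ s in Ioo 0 (2 * R), h (x + s • e) := by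
    intro x hx
    refine (enorm_sq_le_segment hφ x he (exitTime_nonneg Ω e x) (exitTime_le hR he hx)).trans ?_
    rw [mul_assoc 2 L]
    refine add_le_add_right (mul_le_mul_right (mul_le_mul_right ?_ _) _) _
    calc ∫⁻ s in Ioo 0 (exitTime Ω e x), ‖grad φ (x + s • e)‖ₑ ^ 2
        = ∫⁻ s in Ioo 0 (exitTime Ω e x), h (x + s • e) := by
          refine setLIntegral_congr_fun measurableSet_Ioo fun s hs => ?_
          simp only [hh]
          rw [indicator_of_mem (mem_of_lt_exitTime hs.1.le hs.2)]
      _ ≤ _ := lintegral_mono_set (Ioo_subset_Ioo_right (exitTime_le hR he hx))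
  have hcm : Measurable fun x => ‖φ (x + exitTime Ω e x • e)‖ₑ ^ 2 :=
    hφm.comp (measurable_id.add (hem.smul measurable_const))
  have hjm : Measurable (Function.uncurry fun (x : E d) (s : ℝ) => h (x + s • e)) :=
    hhm.comp (by fun_prop)
  have hfub : ∫⁻ x in Ω, ∫⁻ s in Ioo 0 (2 * R), h (x + s • e) ≤ L * ∫⁻ x in Ω, ‖grad φ x‖ₑ ^ 2 := by
    calc ∫⁻ x in Ω, ∫⁻ s in Ioo 0 (2 * R), h (x + s • e)
        ≤ ∫⁻ x, ∫⁻ s in Ioo 0 (2 * R), h (x + s • e) := setLIntegral_le_lintegral _ _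
      _ = ∫⁻ s in Ioo 0 (2 * R), ∫⁻ x, h (x + s • e) :=
          lintegral_lintegral_swap hjm.aemeasurable
      _ = ∫⁻ s in Ioo 0 (2 * R), ∫⁻ x, h x := by
          simp_rw [lintegral_add_right_eq_self h]
      _ = L * ∫⁻ x in Ω, ‖grad φ x‖ₑ ^ 2 := by
          rw [setLIntegral_const, Real.volume_Ioo, sub_zero, mul_comm, hh,
            lintegral_indicator ho.measurableSet]
  calc ∫⁻ x in Ω, ‖φ x‖ₑ ^ 2
      ≤ ∫⁻ x in Ω, (2 * ‖φ (x + exitTime Ω e x • e)‖ₑ ^ 2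
          + 2 * L * ∫⁻ s in Ioo 0 (2 * R), h (x + s • e)) := setLIntegral_mono' ho.measurableSet hpt
    _ = 2 * (∫⁻ x in Ω, ‖φ (x + exitTime Ω e x • e)‖ₑ ^ 2)
          + 2 * L * ∫⁻ x in Ω, ∫⁻ s in Ioo 0 (2 * R), h (x + s • e) := by
        rw [lintegral_add_left (hcm.const_mul 2), lintegral_const_mul _ hcm,
          lintegral_const_mul _ (Measurable.lintegral_prod_right hjm)]
    _ ≤ 2 * (L * ∫⁻ x, ‖φ x‖ₑ ^ 2 ∂(surf Ω)) + 2 * L * (L * ∫⁻ x in Ω, ‖grad φ x‖ₑ ^ 2) := by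
        gcongr
        exact lintegral_exitPoint_le ho hR he hφm
    _ ≤ (2 * (L * L) + 2 * L) * (∫⁻ x, ‖φ x‖ₑ ^ 2 ∂(surf Ω))
          + (2 * (L * L) + 2 * L) * (∫⁻ x in Ω, ‖grad φ x‖ₑ ^ 2) := by
        gcongr ?_ + ?_
        · rw [← mul_assoc]; gcongr; exact le_add_self
        · rw [← mul_assoc, mul_assoc 2 L L]; gcongr; exact le_self_add
    _ = _ := by rw [← mul_add, add_comm (∫⁻ x in Ω, ‖grad φ x‖ₑ ^ 2)]

/-! ### The trace inequality on a `C²` boundary -/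

/-- The parametrization of the graph of `g` over the hyperplane orthogonal to `e`. -/
def graphMap {e : E d} (g : (Submodule.span ℝ {e})ᗮ → ℝ) (y : (Submodule.span ℝ {e})ᗮ) : E d :=
  g y • e + (y : E d)

lemma graphMap_projection {e : E d} (he : ‖e‖ = 1) {g : (Submodule.span ℝ {e})ᗮ → ℝ} {z : E d}
    (hz : inner ℝ e z = g ((Submodule.span ℝ {e})ᗮ.orthogonalProjectionOnto z)) :
    graphMap g ((Submodule.span ℝ {e})ᗮ.orthogonalProjectionOnto z) = z := by
  rw [graphMap, ← hz]
  have h := (Submodule.span ℝ {e}).starProjection_add_starProjection_orthogonal z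
  rw [Submodule.starProjection_unit_singleton ℝ he] at h
  exact h

/-- Near a point of its boundary, `D` lies below a graph, so the boundary is on the graph. -/
lemma inner_eq_of_mem_frontier {D : Set (E d)} (hDo : IsOpen D) {e : E d}
    {g : (Submodule.span ℝ {e})ᗮ → ℝ} (hg : Continuous g) {U : Set (E d)} (hU : IsOpen U)
    (h : ∀ y ∈ U, (y ∈ D ↔ inner ℝ e y < g ((Submodule.span ℝ {e})ᗮ.orthogonalProjectionOnto y)))
    {z : E d} (hzU : z ∈ U) (hz : z ∈ frontier D) :
    inner ℝ e z = g ((Submodule.span ℝ {e})ᗮ.orthogonalProjectionOnto z) := by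
  rw [hDo.frontier_eq] at hz
  refine le_antisymm (not_lt.1 fun hlt => ?_) (not_lt.1 fun hlt => hz.2 ((h z hzU).2 hlt))
  have hop : IsOpen (U ∩ {y | g ((Submodule.span ℝ {e})ᗮ.orthogonalProjectionOnto y)
      < inner ℝ e y}) := hU.inter (isOpen_lt (by fun_prop) (by fun_prop))
  obtain ⟨y, ⟨hyU, hy⟩, hyD⟩ := mem_closure_iff.1 hz.1 _ hop ⟨hzU, hlt⟩
  exact lt_asymm hy ((h y hyU).1 hyD)

/-- The surface measure of a piece of a Lipschitz graph is dominated by the push-forward of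
Lebesgue measure on the hyperplane. -/
lemma lintegral_graph_le {e : E d} (he : ‖e‖ = 1) {g : (Submodule.span ℝ {e})ᗮ → ℝ}
    (hg : Continuous g) {B : Set (Submodule.span ℝ {e})ᗮ} {M : NNReal}
    (hL : LipschitzOnWith M (graphMap g) B) {s : Set (E d)} (hs : s ⊆ graphMap g '' B)
    {f : E d → ℝ≥0∞} (hf : Measurable f) :
    ∫⁻ x in s, f x ∂(μHE[d - 1] : Measure (E d))
      ≤ (M : ℝ≥0∞) ^ (d - 1) * ∫⁻ y in B, f (graphMap g y) := by
  have hG : Measurable (graphMap g) :=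
    (by unfold graphMap; fun_prop : Continuous (graphMap g)).measurable
  have key : (μHE[d - 1] : Measure (E d)).restrict s
      ≤ (M : ℝ≥0∞) ^ (d - 1) • Measure.map (graphMap g) (volume.restrict B) := by
    refine Measure.le_intro fun A hA _ => ?_
    rw [Measure.restrict_apply hA, Measure.smul_apply, Measure.map_apply hG hA,
      Measure.restrict_apply (hG hA), smul_eq_mul, ← hausdorff_hyperplane he]
    refine (measure_mono ?_).trans (euclideanHausdorff_image_le (hL.mono inter_subset_right) _)
    rintro x ⟨hxA, hxs⟩
    obtain ⟨y, hy, rfl⟩ := hs hxs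
    exact ⟨y, ⟨hxA, hy⟩, rfl⟩
  refine (lintegral_mono' key le_rfl).trans ?_
  rw [lintegral_smul_measure, smul_eq_mul, lintegral_map hf hG]

/-- Integrating over a collar below a graph gives at most the integral over the whole set. -/
lemma lintegral_collar_le {Ω : Set (E d)} (hΩ : MeasurableSet Ω) {e : E d} (he : ‖e‖ = 1)
    {g : (Submodule.span ℝ {e})ᗮ → ℝ} {B : Set (Submodule.span ℝ {e})ᗮ} (hB : MeasurableSet B)
    {δ : ℝ} (hcol : ∀ y ∈ B, ∀ s ∈ Ioo 0 δ, graphMap g y + s • (-e) ∈ Ω)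
    {f : E d → ℝ≥0∞} (hf : Measurable f) :
    ∫⁻ y in B, ∫⁻ s in Ioo 0 δ, f (graphMap g y + s • (-e)) ≤ ∫⁻ x in Ω, f x := by
  set F := Ω.indicator f with hF
  have hFm : Measurable F := hf.indicator hΩ
  have hm := measurePreserving_line_add he
  calc ∫⁻ y in B, ∫⁻ s in Ioo 0 δ, f (graphMap g y + s • (-e))
      = ∫⁻ y in B, ∫⁻ s in Ioo 0 δ, F (graphMap g y + s • (-e)) := by
        refine setLIntegral_congr_fun hB fun y hy => ?_
        refine setLIntegral_congr_fun measurableSet_Ioo fun s hs => ?_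
        simp only [hF]
        rw [indicator_of_mem (hcol y hy s hs)]
    _ ≤ ∫⁻ y in B, ∫⁻ t, F (t • e + (y : E d)) := by
        refine lintegral_mono fun y => ?_
        refine (setLIntegral_le_lintegral _ _).trans (le_of_eq ?_)
        rw [← lintegral_sub_left_eq_self (fun t : ℝ => F (t • e + (y : E d))) (g y)]
        refine lintegral_congr fun s => ?_
        congr 1
        simp only [graphMap, sub_smul, smul_neg]
        abel
    _ ≤ ∫⁻ y : (Submodule.span ℝ {e})ᗮ, ∫⁻ t, F (t • e + (y : E d)) := setLIntegral_le_lintegral _ _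
    _ = ∫⁻ p : ℝ × (Submodule.span ℝ {e})ᗮ, F (p.1 • e + (p.2 : E d)) ∂(volume.prod volume) :=
        (lintegral_prod_symm _ (hFm.comp hm.measurable).aemeasurable).symm
    _ = ∫⁻ x, F x := hm.lintegral_comp hFm
    _ = ∫⁻ x in Ω, f x := lintegral_indicator hΩ _

/-- The trace inequality on a set `s`, with values integrated against the `(d-1)`-dimensional
Hausdorff measure. -/
def TraceIneq (Ω s : Set (E d)) : Prop :=
  ∃ C : ℝ≥0∞, C ≠ ⊤ ∧ ∀ φ : E d → ℂ, ContDiff ℝ ∞ φ →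
    ∫⁻ x in s, ‖φ x‖ₑ ^ 2 ∂(μHE[d - 1] : Measure (E d))
      ≤ C * ((∫⁻ x in Ω, ‖φ x‖ₑ ^ 2) + ∫⁻ x in Ω, ‖grad φ x‖ₑ ^ 2)

lemma TraceIneq.of_graph {Ω : Set (E d)} (hΩ : MeasurableSet Ω) {e : E d} (he : ‖e‖ = 1)
    {g : (Submodule.span ℝ {e})ᗮ → ℝ} (hg : Continuous g)
    {B : Set (Submodule.span ℝ {e})ᗮ} (hB : MeasurableSet B) {M : NNReal}
    (hL : LipschitzOnWith M (graphMap g) B) {δ : ℝ} (hδ : 0 < δ)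
    (hcol : ∀ y ∈ B, ∀ s ∈ Ioo 0 δ, graphMap g y + s • (-e) ∈ Ω)
    {s : Set (E d)} (hs : s ⊆ graphMap g '' B) : TraceIneq Ω s := by
  set q := ENNReal.ofReal δ with hq
  have hq0 : q ≠ 0 := by simpa [hq] using hδ
  refine ⟨(M : ℝ≥0∞) ^ (d - 1) * (q⁻¹ * (2 + 2 * q * q)), ?_, fun φ hφ => ?_⟩
  · have : q⁻¹ ≠ ⊤ := ENNReal.inv_ne_top.2 hq0
    finiteness
  have hφm : Measurable fun x => ‖φ x‖ₑ ^ 2 := hφ.continuous.enorm.measurable.pow_const 2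
  have hgm : Measurable fun x => ‖grad φ x‖ₑ ^ 2 := (continuous_grad hφ).enorm.measurable.pow_const 2
  have he' : ‖-e‖ = 1 := by rwa [norm_neg]
  have hcG : Continuous (graphMap g) := by unfold graphMap; fun_prop
  have hcG2 : Continuous fun p : (Submodule.span ℝ {e})ᗮ × ℝ => graphMap g p.1 + p.2 • (-e) := by
    fun_prop
  set I : ((E d) → ℝ≥0∞) → (Submodule.span ℝ {e})ᗮ → ℝ≥0∞ := fun f y =>
    ∫⁻ s in Ioo 0 δ, f (graphMap g y + s • (-e)) with hI
  have hIm : ∀ f, Measurable f → Measurable (I f) := fun f hf =>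
    Measurable.lintegral_prod_right' (f := fun p : (Submodule.span ℝ {e})ᗮ × ℝ =>
      f (graphMap g p.1 + p.2 • (-e))) (hf.comp hcG2.measurable)
  -- The value on the graph is compared with the values on the segment below it, and the
  -- comparison is averaged over the segment.
  have hpt : ∀ y, q * ‖φ (graphMap g y)‖ₑ ^ 2
      ≤ 2 * I (fun x => ‖φ x‖ₑ ^ 2) y + 2 * q * q * I (fun x => ‖grad φ x‖ₑ ^ 2) y := by
    intro y
    have h1 : ∀ s ∈ Ioo 0 δ, ‖φ (graphMap g y)‖ₑ ^ 2 ≤ 2 * ‖φ (graphMap g y + s • (-e))‖ₑ ^ 2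
        + 2 * (q * I (fun x => ‖grad φ x‖ₑ ^ 2) y) := by
      intro s hs
      refine (enorm_sq_le_segment hφ _ he' hs.1.le hs.2.le).trans ?_
      refine add_le_add_right (mul_le_mul_right (mul_le_mul_right ?_ _) _) _
      exact lintegral_mono_set (Ioo_subset_Ioo_right hs.2.le)
    have h2 := setLIntegral_mono' (μ := volume) measurableSet_Ioo h1
    rw [setLIntegral_const, lintegral_add_right _ measurable_const, setLIntegral_const,
      lintegral_const_mul, Real.volume_Ioo, sub_zero, ← hq] at h2
    · rw [mul_comm]
      refine h2.trans (le_of_eq ?_)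
      rw [hI]
      ring
    · exact hφm.comp (by fun_prop : Continuous fun s : ℝ => graphMap g y + s • (-e)).measurable
  have h3 : q * ∫⁻ y in B, ‖φ (graphMap g y)‖ₑ ^ 2
      ≤ 2 * (∫⁻ x in Ω, ‖φ x‖ₑ ^ 2) + 2 * q * q * ∫⁻ x in Ω, ‖grad φ x‖ₑ ^ 2 := by
    have hm : Measurable fun y => ‖φ (graphMap g y)‖ₑ ^ 2 := hφm.comp hcG.measurable
    rw [← lintegral_const_mul _ hm]
    refine (lintegral_mono hpt).trans ?_
    rw [lintegral_add_left ((hIm _ hφm).const_mul 2), lintegral_const_mul _ (hIm _ hφm),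
      lintegral_const_mul _ (hIm _ hgm)]
    exact add_le_add (mul_le_mul_right (lintegral_collar_le hΩ he hB hcol hφm) _)
      (mul_le_mul_right (lintegral_collar_le hΩ he hB hcol hgm) _)
  refine (lintegral_graph_le he hg hL hs hφm).trans ?_
  rw [mul_assoc]
  refine mul_le_mul_right ?_ _
  calc ∫⁻ y in B, ‖φ (graphMap g y)‖ₑ ^ 2
      = q⁻¹ * (q * ∫⁻ y in B, ‖φ (graphMap g y)‖ₑ ^ 2) := by
        rw [← mul_assoc, ENNReal.inv_mul_cancel hq0 ENNReal.ofReal_ne_top, one_mul]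
    _ ≤ q⁻¹ * (2 * (∫⁻ x in Ω, ‖φ x‖ₑ ^ 2) + 2 * q * q * ∫⁻ x in Ω, ‖grad φ x‖ₑ ^ 2) := by gcongr
    _ ≤ q⁻¹ * ((2 + 2 * q * q) * ((∫⁻ x in Ω, ‖φ x‖ₑ ^ 2) + ∫⁻ x in Ω, ‖grad φ x‖ₑ ^ 2)) := by
        gcongr
        rw [mul_add]
        gcongr
        · exact le_self_add
        · exact le_add_self
    _ = _ := (mul_assoc _ _ _).symm

/-- The trace inequality `‖φ‖_{L²(∂D)} ≤ C ‖φ‖_{H¹(Ω)}` for smooth functions. -/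
lemma traceIneq_frontier {Ω D : Set (E d)} (hΩ : IsOpen Ω) (hDo : IsOpen D)
    (hDC : HasC2Boundary D) (hc : IsCompact (frontier D)) (hsub : frontier D ⊆ Ω) :
    TraceIneq Ω (frontier D) := by
  refine hc.induction_on (p := TraceIneq Ω) ⟨0, by simp, fun φ _ => by simp⟩ ?_ ?_ ?_
  · rintro s t hst ⟨C, hC, h⟩
    exact ⟨C, hC, fun φ hφ => (lintegral_mono_set hst).trans (h φ hφ)⟩
  · rintro s t ⟨C, hC, h⟩ ⟨C', hC', h'⟩
    refine ⟨C + C', by finiteness, fun φ hφ => (lintegral_union_le _ _ _).trans ?_⟩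
    rw [add_mul]
    exact add_le_add (h φ hφ) (h' φ hφ)
  intro x hx
  obtain ⟨e, he, g, hg, U, hU, hxU, hDU⟩ := hDC x hx
  set P := (Submodule.span ℝ {e})ᗮ.orthogonalProjectionOnto with hP
  have hgc := hg.continuous
  have hGc : Continuous (graphMap g) := by unfold graphMap; fun_prop
  have hGx : graphMap g (P x) = x :=
    graphMap_projection he (inner_eq_of_mem_frontier hDo hgc hU hDU hxU hx)
  obtain ⟨ρ, hρ, hball⟩ := Metric.isOpen_iff.1 hΩ x (hsub hx)
  have hGd : ContDiff ℝ 1 (graphMap g) := by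
    have : ContDiff ℝ 1 g := hg.of_le (by norm_num)
    unfold graphMap
    exact (this.smul contDiff_const).add ((Submodule.span ℝ {e})ᗮ.subtypeL).contDiff
  obtain ⟨M, t, ht, hLt⟩ := hGd.contDiffAt.exists_lipschitzOnWith (x := P x)
  have hnear : graphMap g ⁻¹' Metric.ball x (ρ / 2) ∈ 𝓝 (P x) := by
    refine hGc.continuousAt.preimage_mem_nhds ?_
    rw [hGx]
    exact Metric.ball_mem_nhds x (half_pos hρ)
  obtain ⟨B, hBsub, hBo, hxB⟩ := mem_nhds_iff.1 (inter_mem ht hnear)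
  refine ⟨P ⁻¹' B ∩ U ∩ frontier D, ?_, ?_⟩
  · refine inter_mem (mem_nhdsWithin_of_mem_nhds ?_) self_mem_nhdsWithin
    exact ((hBo.preimage (by fun_prop)).inter hU).mem_nhds ⟨hxB, hxU⟩
  refine TraceIneq.of_graph hΩ.measurableSet he hgc hBo.measurableSet
    (hLt.mono fun y hy => (hBsub hy).1) (half_pos hρ) ?_ ?_
  · intro y hy s hs
    refine hball ?_
    have h1 : ‖graphMap g y - x‖ < ρ / 2 := mem_ball_iff_norm.1 (hBsub hy).2
    have h2 : ‖s • (-e)‖ = s := by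
      rw [norm_smul, norm_neg, he, mul_one, Real.norm_of_nonneg hs.1.le]
    rw [mem_ball_iff_norm, add_sub_right_comm]
    refine (norm_add_le _ _).trans_lt ?_
    rw [h2]
    linarith [hs.2]
  · rintro z ⟨⟨hzB, hzU⟩, hz⟩
    exact ⟨P z, hzB, graphMap_projection he (inner_eq_of_mem_frontier hDo hgc hU hDU hzU hz)⟩

lemma TraceIneq.measure_lt_top {Ω s : Set (E d)} (h : TraceIneq Ω s)
    (hb : Bornology.IsBounded Ω) : (μHE[d - 1] : Measure (E d)) s < ⊤ := by
  obtain ⟨C, hC, h⟩ := h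
  have h1 := h (fun _ => 1) contDiff_const
  have h0 : ∀ x, grad (fun _ : E d => (1 : ℂ)) x = 0 := by
    intro x; ext i; simp [grad, partialD]
  simp only [enorm_one, one_pow, lintegral_const, Measure.restrict_apply MeasurableSet.univ,
    univ_inter, one_mul, h0, enorm_zero, ne_eq, OfNat.ofNat_ne_zero, not_false_eq_true, zero_pow,
    zero_mul, add_zero] at h1
  exact h1.trans_lt (ENNReal.mul_lt_top hC.lt_top hb.measure_lt_top)

lemma TraceIneq.volume_eq_zero {Ω s : Set (E d)} (hd : 0 < d) (h : TraceIneq Ω s)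
    (hb : Bornology.IsBounded Ω) : volume s = 0 := by
  have h1 := Measure.euclideanHausdorffMeasure_zero_or_top (X := E d) (Nat.sub_lt hd one_pos) s
  have h2 : (μHE[d] : Measure (E d)) = volume := EuclideanSpace.euclideanHausdorffMeasure_eq_volume d
  rw [h2] at h1
  exact h1.resolve_right (h.measure_lt_top hb).ne

/-! ### The Sobolev space -/

/-- The gradient as a map from `H¹(Ω)` to `L²(Ω)^d`. -/
noncomputable def gradL (Ω : Set (E d)) :
    H1 Ω →L[ℂ] Lp (EuclideanSpace ℂ (Fin d)) 2 ((volume : Measure (E d)).restrict Ω) :=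
  (WithLp.sndL 2 ℂ _ _).comp (H1 Ω).subtypeL

lemma H1_norm_sq {Ω : Set (E d)} (u : H1 Ω) : ‖u‖ ^ 2 = ‖H1fn u‖ ^ 2 + ‖H1grad u‖ ^ 2 :=
  WithLp.prod_norm_sq_eq_of_L2 (u : L2Pair Ω)

lemma norm_H1fn_le {Ω : Set (E d)} (u : H1 Ω) : ‖H1fn u‖ ≤ ‖u‖ := by
  refine le_of_sq_le_sq ?_ (norm_nonneg _)
  rw [H1_norm_sq]; nlinarith [sq_nonneg ‖H1grad u‖]

lemma norm_H1grad_le {Ω : Set (E d)} (u : H1 Ω) : ‖H1grad u‖ ≤ ‖u‖ := by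
  refine le_of_sq_le_sq ?_ (norm_nonneg _)
  rw [H1_norm_sq]; nlinarith [sq_nonneg ‖H1fn u‖]

lemma continuous_integral_smul {α : Type*} [MeasurableSpace α] {μ : Measure α} {f : α → ℝ}
    (hf : MemLp f 2 μ) : Continuous fun u : Lp ℂ 2 μ => ∫ x, f x • u x ∂μ := by
  have hc : MemLp (fun x => (f x : ℂ)) 2 μ := hf.ofReal
  have : (fun u : Lp ℂ 2 μ => ∫ x, f x • u x ∂μ) = fun u => inner ℂ hc.toLp u := by
    ext u
    rw [L2.inner_def]
    refine integral_congr_ae ?_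
    filter_upwards [hc.coeFn_toLp] with x hx
    rw [hx]
    simp [mul_comm]
  rw [this]
  fun_prop

lemma isClosed_H1 (Ω : Set (E d)) : IsClosed (H1 Ω : Set (L2Pair Ω)) := by
  have : (H1 Ω : Set (L2Pair Ω)) = {p | IsWeakGrad Ω p.fst p.snd} := rfl
  rw [this]
  simp only [IsWeakGrad, ofPred_forall]
  refine isClosed_iInter fun φ => isClosed_iInter fun hφ => isClosed_iInter fun hc =>
    isClosed_iInter fun hs => isClosed_iInter fun i => isClosed_eq ?_ ?_
  · exact (continuous_integral_smul (partialD_memLp i hφ hc _)).comp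
      (WithLp.fstL 2 ℂ _ _).continuous
  · have hv : MemLp φ 2 (volume.restrict Ω) := hφ.continuous.memLp_of_hasCompactSupport hc
    have h1 := ((continuous_integral_smul hv).comp
      ((EuclideanSpace.proj i : EuclideanSpace ℂ (Fin d) →L[ℂ] ℂ).compLpL 2
        (volume.restrict Ω)).continuous).comp (WithLp.sndL 2 ℂ (Lp ℂ 2 (volume.restrict Ω))
        (Lp (EuclideanSpace ℂ (Fin d)) 2 (volume.restrict Ω))).continuous
    refine (h1.congr fun p => ?_).neg
    refine integral_congr_ae ?_
    filter_upwards [ContinuousLinearMap.coeFn_compLpL (p := 2) (μ := volume.restrict Ω)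
      (EuclideanSpace.proj i : EuclideanSpace ℂ (Fin d) →L[ℂ] ℂ) p.snd] with x hx
    exact congrArg (fun z => φ x • z) hx

instance (Ω : Set (E d)) : CompleteSpace (H1 Ω) := (isClosed_H1 Ω).completeSpace_coe

lemma exists_H1 {Ω : Set (E d)} {f : E d → ℂ} {G : E d → EuclideanSpace ℂ (Fin d)}
    (hf : MemLp f 2 (volume.restrict Ω)) (hG : MemLp G 2 (volume.restrict Ω))
    (h : IsWeakGrad Ω f G) : ∃ u : H1 Ω, H1fn u =ᵐ[volume.restrict Ω] f ∧
      H1grad u =ᵐ[volume.restrict Ω] G := by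
  refine ⟨⟨WithLp.toLp 2 (hf.toLp, hG.toLp), fun φ hφ hc hs i => ?_⟩, hf.coeFn_toLp, hG.coeFn_toLp⟩
  have e1 : ∫ x in Ω, partialD i φ x • hf.toLp f x = ∫ x in Ω, partialD i φ x • f x := by
    refine integral_congr_ae ?_
    filter_upwards [hf.coeFn_toLp] with x hx
    rw [hx]
  have e2 : ∫ x in Ω, φ x • hG.toLp G x i = ∫ x in Ω, φ x • G x i := by
    refine integral_congr_ae ?_
    filter_upwards [hG.coeFn_toLp] with x hx
    rw [hx]
  exact e1.trans ((h φ hφ hc hs i).trans (congrArg _ e2.symm))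

/-- A function in `H¹(Ω)` that vanishes almost everywhere is zero: its weak gradient is
orthogonal to all test functions. -/
lemma H1_eq_zero {Ω : Set (E d)} (hΩ : IsOpen Ω) (hb : Bornology.IsBounded Ω) {u : H1 Ω}
    (h : H1fn u =ᵐ[volume.restrict Ω] 0) : u = 0 := by
  have : IsFiniteMeasure ((volume : Measure (E d)).restrict Ω) :=
    ⟨by simpa using hb.measure_lt_top⟩
  have hG : ∀ i : Fin d, ∀ᵐ x ∂volume, x ∈ Ω → H1grad u x i = 0 := by
    intro i
    have hint : IntegrableOn (fun x => H1grad u x i) Ω :=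
      (memLp_coord (H1grad u) i).integrable (by norm_num)
    refine hΩ.ae_eq_zero_of_integral_contDiff_smul_eq_zero hint.locallyIntegrableOn
      fun φ hφ hc hs => ?_
    have h1 := u.2 φ hφ hc hs i
    have h2 : ∫ x in Ω, partialD i φ x • H1fn u x = 0 := by
      refine integral_eq_zero_of_ae ?_
      filter_upwards [h] with x hx
      simp [hx]
    have h3 : ∫ x in Ω, φ x • H1grad u x i = 0 := by
      have := h2.symm.trans h1
      exact neg_eq_zero.1 this.symm
    rw [← h3]
    refine (setIntegral_eq_integral_of_forall_compl_eq_zero fun x hx => ?_).symm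
    rw [image_eq_zero_of_notMem_tsupport fun hx' => hx (hs hx'), zero_smul]
  have h0 : H1fn u = 0 := (Lp.eq_zero_iff_ae_eq_zero).2 h
  have h1 : H1grad u = 0 := by
    rw [Lp.eq_zero_iff_ae_eq_zero]
    filter_upwards [ae_restrict_mem hΩ.measurableSet,
      ae_restrict_of_ae (ae_all_iff.2 hG)] with x hx hx2
    ext i
    exact hx2 i hx
  have h2 := H1_norm_sq u
  rw [h0, h1] at h2
  exact norm_eq_zero.1 (by simpa using h2)

lemma memLp_of_continuous {F : Type*} [NormedAddCommGroup F] {f : E d → F} (hf : Continuous f)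
    {μ : Measure (E d)} {s : Set (E d)} (hs : MeasurableSet s) (hb : Bornology.IsBounded s)
    (hμ : μ s < ⊤) : MemLp f 2 (μ.restrict s) := by
  have : IsFiniteMeasure (μ.restrict s) := ⟨by simpa using hμ⟩
  obtain ⟨C, hC⟩ := (hb.isCompact_closure).exists_bound_of_continuousOn hf.continuousOn
  refine MemLp.of_bound hf.aestronglyMeasurable C ?_
  filter_upwards [ae_restrict_mem hs] with x hx
  exact hC x (subset_closure hx)

/-- A smooth function has its classical gradient as weak gradient. -/
lemma isWeakGrad_smooth (Ω : Set (E d)) {φ : E d → ℂ} (hφ : ContDiff ℝ ∞ φ) :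
    IsWeakGrad Ω φ (grad φ) := by
  intro ψ hψ hc hs i
  have hz : ∀ x, x ∉ Ω → ψ x = 0 := fun x hx =>
    image_eq_zero_of_notMem_tsupport fun hx' => hx (hs hx')
  have hz' : ∀ x, x ∉ Ω → partialD i ψ x = 0 := fun x hx => by
    have : fderiv ℝ ψ x = 0 := by
      refine image_eq_zero_of_notMem_tsupport fun hx' => hx (hs (tsupport_fderiv_subset ℝ hx'))
    simp [partialD, this]
  rw [setIntegral_eq_integral_of_forall_compl_eq_zero fun x hx => by rw [hz' x hx, zero_smul],
    setIntegral_eq_integral_of_forall_compl_eq_zero fun x hx => by rw [hz x hx, zero_smul]]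
  have c1 : Continuous (partialD i ψ) := by
    have := hψ.continuous_fderiv (by simp)
    unfold partialD; fun_prop
  have c2 : Continuous (partialD i φ) := by
    have := hφ.continuous_fderiv (by simp)
    unfold partialD; fun_prop
  have s1 : HasCompactSupport (partialD i ψ) := hc.fderiv_apply ℝ _
  have key := integral_smul_fderiv_eq_neg_fderiv_smul_of_integrable (μ := volume) (𝕜 := ℝ)
    (f := ψ) (g := φ) (v := EuclideanSpace.single i (1 : ℝ))
    ((c1.smul hφ.continuous).integrable_of_hasCompactSupport s1.smul_right)
    ((hψ.continuous.smul c2).integrable_of_hasCompactSupport hc.smul_right)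
    ((hψ.continuous.smul hφ.continuous).integrable_of_hasCompactSupport hc.smul_right)
    (fun x _ => hψ.differentiable (by simp) x) (fun x _ => hφ.differentiable (by simp) x)
  change ∫ x, partialD i ψ x • φ x = -∫ x, ψ x • partialD i φ x
  rw [eq_neg_iff_add_eq_zero, add_comm, ← eq_neg_iff_add_eq_zero]
  exact key

lemma exists_H1_smooth {Ω : Set (E d)} (hΩ : IsOpen Ω) (hb : Bornology.IsBounded Ω) {φ : E d → ℂ}
    (hφ : ContDiff ℝ ∞ φ) : ∃ u : H1 Ω, H1fn u =ᵐ[volume.restrict Ω] φ ∧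
      H1grad u =ᵐ[volume.restrict Ω] grad φ :=
  exists_H1 (memLp_of_continuous hφ.continuous hΩ.measurableSet hb hb.measure_lt_top)
    (memLp_of_continuous (continuous_grad hφ) hΩ.measurableSet hb hb.measure_lt_top)
    (isWeakGrad_smooth Ω hφ)

lemma grad_ofReal_apply (χ : E d → ℝ) (hχ : ContDiff ℝ ∞ χ) (x : E d) (i : Fin d) :
    grad (fun y => (χ y : ℂ)) x i = ((partialD i χ x : ℝ) : ℂ) := by
  have h : HasFDerivAt χ (fderiv ℝ χ x) x := (hχ.differentiable (by simp) x).hasFDerivAt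
  have h2 := (Complex.ofRealCLM.hasFDerivAt (x := χ x)).comp x h
  simp only [grad, partialD]
  have h3 : fderiv ℝ (fun y => (χ y : ℂ)) x = Complex.ofRealCLM.comp (fderiv ℝ χ x) := h2.fderiv
  rw [h3]
  simp

lemma grad_mul {φ ψ : E d → ℂ} (hφ : ContDiff ℝ ∞ φ) (hψ : ContDiff ℝ ∞ ψ) (x : E d) :
    grad (fun y => φ y * ψ y) x = φ x • grad ψ x + ψ x • grad φ x := by
  have h1 : DifferentiableAt ℝ φ x := hφ.differentiable (by simp) x
  have h2 : DifferentiableAt ℝ ψ x := hψ.differentiable (by simp) x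
  ext i
  simp [grad, partialD, fderiv_fun_mul h1 h2]

/-- The product of a function in `H¹(Ω)` with a smooth function, and its gradient. -/
lemma exists_H1_mul {Ω : Set (E d)} (hΩ : IsOpen Ω) (hb : Bornology.IsBounded Ω) {χ : E d → ℝ}
    (hχ : ContDiff ℝ ∞ χ) (u : H1 Ω) : ∃ v : H1 Ω,
      H1fn v =ᵐ[volume.restrict Ω] (fun x => (χ x : ℂ) * H1fn u x) ∧
      H1grad v =ᵐ[volume.restrict Ω]
        (fun x => (χ x : ℂ) • H1grad u x + H1fn u x • grad (fun y => (χ y : ℂ)) x) := by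
  have hχc : ContDiff ℝ ∞ (fun x => (χ x : ℂ)) := Complex.ofRealCLM.contDiff.comp hχ
  obtain ⟨C, hC⟩ := hb.isCompact_closure.exists_bound_of_continuousOn hχc.continuous.continuousOn
  obtain ⟨C', hC'⟩ :=
    hb.isCompact_closure.exists_bound_of_continuousOn (continuous_grad hχc).continuousOn
  have hmem := ae_restrict_mem (μ := volume) hΩ.measurableSet
  have m1 : MemLp (fun x => (χ x : ℂ) * H1fn u x) 2 (volume.restrict Ω) := by
    refine (Lp.memLp (H1fn u)).of_le_mul (c := C)
      (hχc.continuous.aestronglyMeasurable.mul (Lp.aestronglyMeasurable _)) ?_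
    filter_upwards [hmem] with x hx
    rw [norm_mul]
    gcongr
    exact hC x (subset_closure hx)
  have m2 : MemLp (fun x => (χ x : ℂ) • H1grad u x) 2 (volume.restrict Ω) := by
    refine (Lp.memLp (H1grad u)).of_le_mul (c := C)
      (hχc.continuous.aestronglyMeasurable.smul (Lp.aestronglyMeasurable _)) ?_
    filter_upwards [hmem] with x hx
    rw [norm_smul]
    gcongr
    exact hC x (subset_closure hx)
  have m3 : MemLp (fun x => H1fn u x • grad (fun y => (χ y : ℂ)) x) 2 (volume.restrict Ω) := by
    refine (Lp.memLp (H1fn u)).of_le_mul (c := C')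
      ((Lp.aestronglyMeasurable (H1fn u)).smul (continuous_grad hχc).aestronglyMeasurable) ?_
    filter_upwards [hmem] with x hx
    rw [norm_smul, mul_comm]
    gcongr
    exact hC' x (subset_closure hx)
  refine exists_H1 m1 (m2.add m3) fun ψ hψ hc hs i => ?_
  have hp : ∀ x, partialD i (fun y => ψ y * χ y) x = partialD i ψ x * χ x + ψ x * partialD i χ x := by
    intro x
    have h1 : DifferentiableAt ℝ ψ x := hψ.differentiable (by simp) x
    have h2 : DifferentiableAt ℝ χ x := hχ.differentiable (by simp) x
    simp [partialD, fderiv_fun_mul h1 h2]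
    ring
  have hψχ : ContDiff ℝ ∞ fun y => ψ y * χ y := hψ.mul hχ
  have hcs : HasCompactSupport fun y => ψ y * χ y := hc.mul_right
  have key := u.2 _ hψχ hcs ((tsupport_mul_subset_left).trans hs) i
  have cχ : Continuous (partialD i χ) := by
    have := hχ.continuous_fderiv (by simp)
    unfold partialD; fun_prop
  have i1 : Integrable (fun x => partialD i (fun y => ψ y * χ y) x • H1fn u x)
      (volume.restrict Ω) := smulInt (partialD_memLp i hψχ hcs _) (Lp.memLp _)
  have i2 : Integrable (fun x => (ψ x * partialD i χ x) • H1fn u x) (volume.restrict Ω) :=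
    smulInt ((hψ.continuous.mul cχ).memLp_of_hasCompactSupport hc.mul_right) (Lp.memLp _)
  have i3 : Integrable (fun x => (ψ x * χ x) • H1grad u x i) (volume.restrict Ω) :=
    smulInt (hψχ.continuous.memLp_of_hasCompactSupport hcs) (memLp_coord _ i)
  calc ∫ x in Ω, partialD i ψ x • ((χ x : ℂ) * H1fn u x)
      = ∫ x in Ω, (partialD i (fun y => ψ y * χ y) x • H1fn u x
          - (ψ x * partialD i χ x) • H1fn u x) := by
        refine integral_congr_ae (Eventually.of_forall fun x => ?_)
        simp only [hp, Complex.real_smul]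
        push_cast
        ring
    _ = - (∫ x in Ω, (ψ x * χ x) • H1grad u x i)
          - ∫ x in Ω, (ψ x * partialD i χ x) • H1fn u x := by
        rw [integral_sub i1 i2]
        exact congrArg (· - _) key
    _ = - ∫ x in Ω, ((ψ x * χ x) • H1grad u x i + (ψ x * partialD i χ x) • H1fn u x) := by
        rw [integral_add i3 i2]; ring
    _ = _ := by
        congr 1
        refine integral_congr_ae (Eventually.of_forall fun x => ?_)
        simp only [PiLp.add_apply, PiLp.smul_apply, grad_ofReal_apply χ hχ,
          Complex.real_smul, smul_eq_mul]
        push_cast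
        ring

/-! ### Traces -/

lemma eLpNorm_le_sub_add {α F : Type*} [MeasurableSpace α] {μ : Measure α} [NormedAddCommGroup F]
    {f : α → F} (hf : AEStronglyMeasurable f μ) (a : Lp F 2 μ) :
    eLpNorm f 2 μ ≤ eLpNorm (fun x => f x - a x) 2 μ + ‖a‖ₑ := by
  have h := eLpNorm_add_le (hf.sub (Lp.aestronglyMeasurable a)) (Lp.aestronglyMeasurable a)
    (p := 2) (by norm_num)
  rw [sub_add_cancel] at h
  rw [Lp.enorm_def]
  exact h

lemma enorm_le_sub_add {α F : Type*} [MeasurableSpace α] {μ : Measure α} [NormedAddCommGroup F]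
    {f : α → F} (hf : AEStronglyMeasurable f μ) (a : Lp F 2 μ) :
    ‖a‖ₑ ≤ eLpNorm (fun x => f x - a x) 2 μ + eLpNorm f 2 μ := by
  have h := eLpNorm_sub_le hf (hf.sub (Lp.aestronglyMeasurable a)) (p := 2) (by norm_num)
  rw [sub_sub_cancel] at h
  rw [Lp.enorm_def, add_comm]
  exact h

lemma eLpNorm_sub_le_sub_add {α F : Type*} [MeasurableSpace α] {μ : Measure α}
    [NormedAddCommGroup F] {f : α → F} (hf : AEStronglyMeasurable f μ) (a b : Lp F 2 μ) :
    eLpNorm (fun x => f x - b x) 2 μ ≤ eLpNorm (fun x => f x - a x) 2 μ + ‖a - b‖ₑ := by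
  have h := eLpNorm_add_le (hf.sub (Lp.aestronglyMeasurable a))
    (Lp.aestronglyMeasurable (a - b)) (p := 2) (by norm_num)
  rw [Lp.enorm_def]
  refine le_trans (le_of_eq (eLpNorm_congr_ae ?_)) h
  filter_upwards [Lp.coeFn_sub a b] with x hx
  simp only [Pi.add_apply, Pi.sub_apply, hx]
  abel

/-- The total error of the approximation of `u` and its trace `τ` by a smooth function. -/
noncomputable def traceErr {Ω : Set (E d)} (s : Set (E d)) (u : H1 Ω) (τ : L2b s) (φ : E d → ℂ) :
    ℝ≥0∞ :=
  eLpNorm (fun x => φ x - H1fn u x) 2 (volume.restrict Ω)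
    + eLpNorm (fun x => grad φ x - H1grad u x) 2 (volume.restrict Ω)
    + eLpNorm (fun x => φ x - τ x) 2 (surf s)

lemma isTrace_iff {Ω s : Set (E d)} {u : H1 Ω} {τ : L2b s} :
    IsTrace s u τ ↔ ∀ ε : ℝ≥0∞, 0 < ε → ∃ φ : E d → ℂ, ContDiff ℝ ∞ φ ∧ traceErr s u τ φ ≤ ε := by
  constructor
  · rintro ⟨φ, hφ, a1, a2, a3⟩ ε hε
    have h := (a1.add a2).add a3
    simp only [add_zero] at h
    obtain ⟨n, hn⟩ := (h.eventually (ge_mem_nhds hε)).exists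
    exact ⟨φ n, hφ n, hn⟩
  · intro h
    have hpos : ∀ n : ℕ, (0 : ℝ≥0∞) < (n : ℝ≥0∞)⁻¹ := fun n =>
      ENNReal.inv_pos.2 (ENNReal.natCast_ne_top n)
    choose φ hφ hle using fun n : ℕ => h _ (hpos n)
    refine ⟨φ, hφ, ?_, ?_, ?_⟩
    · refine tendsto_of_tendsto_of_tendsto_of_le_of_le tendsto_const_nhds
        ENNReal.tendsto_inv_nat_nhds_zero (fun _ => zero_le) fun n => le_trans ?_ (hle n)
      rw [traceErr, add_assoc]; exact le_self_add
    · refine tendsto_of_tendsto_of_tendsto_of_le_of_le tendsto_const_nhds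
        ENNReal.tendsto_inv_nat_nhds_zero (fun _ => zero_le) fun n => le_trans ?_ (hle n)
      exact le_add_self.trans le_self_add
    · refine tendsto_of_tendsto_of_tendsto_of_le_of_le tendsto_const_nhds
        ENNReal.tendsto_inv_nat_nhds_zero (fun _ => zero_le) fun n => le_trans ?_ (hle n)
      exact le_add_self

lemma traceErr_le {Ω s : Set (E d)} (u v : H1 Ω) (τ σ : L2b s) {φ : E d → ℂ}
    (hφ : ContDiff ℝ ∞ φ) :
    traceErr s v σ φ ≤ traceErr s u τ φ + (2 * ‖u - v‖ₑ + ‖τ - σ‖ₑ) := by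
  have h1 : ‖H1fn u - H1fn v‖ₑ ≤ ‖u - v‖ₑ := enorm_le_iff_norm_le.2 (norm_H1fn_le (u - v))
  have h2 : ‖H1grad u - H1grad v‖ₑ ≤ ‖u - v‖ₑ := enorm_le_iff_norm_le.2 (norm_H1grad_le (u - v))
  calc traceErr s v σ φ
      ≤ (eLpNorm (fun x => φ x - H1fn u x) 2 (volume.restrict Ω) + ‖u - v‖ₑ)
        + (eLpNorm (fun x => grad φ x - H1grad u x) 2 (volume.restrict Ω) + ‖u - v‖ₑ)
        + (eLpNorm (fun x => φ x - τ x) 2 (surf s) + ‖τ - σ‖ₑ) := by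
        refine add_le_add (add_le_add ?_ ?_) ?_
        · exact (eLpNorm_sub_le_sub_add hφ.continuous.aestronglyMeasurable _ _).trans
            (add_le_add_right h1 _)
        · exact (eLpNorm_sub_le_sub_add (continuous_grad hφ).aestronglyMeasurable _ _).trans
            (add_le_add_right h2 _)
        · exact eLpNorm_sub_le_sub_add hφ.continuous.aestronglyMeasurable _ _
    _ = _ := by rw [traceErr]; ring

/-- The trace relation is a closed subset of `H¹(Ω) × L²(∂s)`. -/
lemma isClosed_isTrace (Ω s : Set (E d)) : IsClosed {p : H1 Ω × L2b s | IsTrace s p.1 p.2} := by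
  refine isClosed_of_closure_subset fun p hp => isTrace_iff.2 fun ε hε => ?_
  have hε4 : 0 < ε / 4 := ENNReal.div_pos hε.ne' (by norm_num)
  obtain ⟨q, hq, hpq⟩ := EMetric.mem_closure_iff.1 hp (ε / 4) hε4
  obtain ⟨φ, hφ, hle⟩ := isTrace_iff.1 hq (ε / 4) hε4
  refine ⟨φ, hφ, (traceErr_le q.1 p.1 q.2 p.2 hφ).trans ?_⟩
  rw [edist_comm, Prod.edist_eq] at hpq
  have h1 : ‖q.1 - p.1‖ₑ ≤ ε / 4 := by
    rw [← edist_eq_enorm_sub]; exact (le_max_left _ _).trans hpq.le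
  have h2 : ‖q.2 - p.2‖ₑ ≤ ε / 4 := by
    rw [← edist_eq_enorm_sub]; exact (le_max_right _ _).trans hpq.le
  calc traceErr s q.1 q.2 φ + (2 * ‖q.1 - p.1‖ₑ + ‖q.2 - p.2‖ₑ)
      ≤ ε / 4 + (2 * (ε / 4) + ε / 4) := by gcongr
    _ = 4 * (ε / 4) := by ring
    _ = ε := ENNReal.mul_div_cancel (by norm_num) (by norm_num)

lemma isTrace_of_smooth {Ω s : Set (E d)} {u : H1 Ω} {τ : L2b s} {φ : E d → ℂ}
    (hφ : ContDiff ℝ ∞ φ) (h1 : H1fn u =ᵐ[volume.restrict Ω] φ)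
    (h2 : H1grad u =ᵐ[volume.restrict Ω] grad φ) (h3 : τ =ᵐ[surf s] φ) : IsTrace s u τ := by
  refine isTrace_iff.2 fun ε _ => ⟨φ, hφ, ?_⟩
  have e1 : eLpNorm (fun x => φ x - H1fn u x) 2 (volume.restrict Ω) = 0 := by
    refine (eLpNorm_congr_ae (g := 0) ?_).trans eLpNorm_zero
    filter_upwards [h1] with x hx
    simp [hx]
  have e2 : eLpNorm (fun x => grad φ x - H1grad u x) 2 (volume.restrict Ω) = 0 := by
    refine (eLpNorm_congr_ae (g := 0) ?_).trans eLpNorm_zero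
    filter_upwards [h2] with x hx
    simp [hx]
  have e3 : eLpNorm (fun x => φ x - τ x) 2 (surf s) = 0 := by
    refine (eLpNorm_congr_ae (g := 0) ?_).trans eLpNorm_zero
    filter_upwards [h3] with x hx
    simp [hx]
  rw [traceErr, e1, e2, e3]
  simp

/-- The trace of a product with a smooth function is the product of the traces. -/
lemma IsTrace.mul {Ω s : Set (E d)} (hΩ : IsOpen Ω) (hb : Bornology.IsBounded Ω)
    {u v : H1 Ω} {τ σ : L2b s} (h : IsTrace s u τ) {χ : E d → ℝ} (hχ : ContDiff ℝ ∞ χ)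
    (hχ1 : ∀ x, |χ x| ≤ 1)
    (hv : H1fn v =ᵐ[volume.restrict Ω] (fun x => (χ x : ℂ) * H1fn u x))
    (hv' : H1grad v =ᵐ[volume.restrict Ω]
        (fun x => (χ x : ℂ) • H1grad u x + H1fn u x • grad (fun y => (χ y : ℂ)) x))
    (hσ : σ =ᵐ[surf s] (fun x => (χ x : ℂ) * τ x)) : IsTrace s v σ := by
  obtain ⟨φ, hφ, a1, a2, a3⟩ := h
  have hχc : ContDiff ℝ ∞ (fun x => (χ x : ℂ)) := Complex.ofRealCLM.contDiff.comp hχ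
  have hχn : ∀ x, ‖(χ x : ℂ)‖ ≤ 1 := fun x => by simpa using hχ1 x
  obtain ⟨C, hC⟩ :=
    hb.isCompact_closure.exists_bound_of_continuousOn (continuous_grad hχc).continuousOn
  have hmem := ae_restrict_mem (μ := volume) hΩ.measurableSet
  have hsq : ∀ {c : ℝ≥0∞} (_ : c ≠ ⊤) {f g : ℕ → ℝ≥0∞}, Tendsto g atTop (𝓝 0) →
      (∀ n, f n ≤ c * g n) → Tendsto f atTop (𝓝 0) := by
    intro c hc f g hg hfg
    have := ENNReal.Tendsto.const_mul hg (Or.inr hc)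
    rw [mul_zero] at this
    exact tendsto_of_tendsto_of_tendsto_of_le_of_le tendsto_const_nhds this (fun _ => zero_le) hfg
  refine ⟨fun n x => χ x * φ n x, fun n => hχc.mul (hφ n), ?_, ?_, ?_⟩
  · refine hsq ENNReal.ofReal_ne_top a1 (fun n =>
      eLpNorm_le_mul_eLpNorm_of_ae_le_mul (c := 1) ?_ 2)
    filter_upwards [hv] with x hx
    rw [hx, ← mul_sub, norm_mul]
    exact mul_le_mul_of_nonneg_right (hχn x) (norm_nonneg _)
  · have b1 : Tendsto (fun n => eLpNorm (fun x => (χ x : ℂ) • (grad (φ n) x - H1grad u x)) 2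
        (volume.restrict Ω)) atTop (𝓝 0) := by
      refine hsq ENNReal.ofReal_ne_top a2 (fun n =>
        eLpNorm_le_mul_eLpNorm_of_ae_le_mul (c := 1) ?_ 2)
      filter_upwards with x
      rw [norm_smul]
      exact mul_le_mul_of_nonneg_right (hχn x) (norm_nonneg _)
    have b2 : Tendsto (fun n => eLpNorm (fun x => (φ n x - H1fn u x) • grad (fun y => (χ y : ℂ)) x)
        2 (volume.restrict Ω)) atTop (𝓝 0) := by
      refine hsq ENNReal.ofReal_ne_top a1 (fun n =>
        eLpNorm_le_mul_eLpNorm_of_ae_le_mul (c := C) ?_ 2)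
      filter_upwards [hmem] with x hx
      rw [norm_smul, mul_comm]
      exact mul_le_mul_of_nonneg_right (hC x (subset_closure hx)) (norm_nonneg _)
    refine tendsto_eLpNorm_lin (k := 1) (fun n => ?_) (fun n => ?_) b1 b2 (fun n => ?_)
    · exact hχc.continuous.aestronglyMeasurable.smul
        ((continuous_grad (hφ n)).aestronglyMeasurable.sub (Lp.aestronglyMeasurable _))
    · exact ((hφ n).continuous.aestronglyMeasurable.sub (Lp.aestronglyMeasurable (H1fn u))).smul
        (continuous_grad hχc).aestronglyMeasurable
    · filter_upwards [hv'] with x hx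
      rw [hx, grad_mul hχc (hφ n)]
      simp only [Pi.add_apply, one_smul, smul_sub, sub_smul]
      abel
  · refine hsq ENNReal.ofReal_ne_top a3 (fun n =>
      eLpNorm_le_mul_eLpNorm_of_ae_le_mul (c := 1) ?_ 2)
    filter_upwards [hσ] with x hx
    rw [hx, ← mul_sub, norm_mul]
    exact mul_le_mul_of_nonneg_right (hχn x) (norm_nonneg _)

lemma eLpNorm_two_sq {α F : Type*} [MeasurableSpace α] (μ : Measure α) [NormedAddCommGroup F]
    (f : α → F) : eLpNorm f 2 μ ^ 2 = ∫⁻ x, ‖f x‖ₑ ^ 2 ∂μ := by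
  have := eLpNorm_nnreal_pow_eq_lintegral (μ := μ) (f := f) (p := 2) two_ne_zero
  simpa using this

lemma le_of_sq_le_mul_sq_add {x a b C : ℝ≥0∞} (h : x ^ 2 ≤ C * (a ^ 2 + b ^ 2)) :
    x ≤ (1 + C) * (a + b) := by
  refine le_of_not_gt fun hlt => ?_
  have h1 := ENNReal.pow_right_strictMono two_ne_zero hlt
  refine absurd h (not_le.2 (lt_of_le_of_lt ?_ h1))
  simp only [mul_pow]
  gcongr
  · calc C ≤ C + (1 + C + C ^ 2) := le_self_add
      _ = (1 + C) ^ 2 := by ring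
  · calc a ^ 2 + b ^ 2 ≤ a ^ 2 + b ^ 2 + 2 * a * b := le_self_add
      _ = (a + b) ^ 2 := by ring

/-- The trace inequality in terms of `L²` norms. -/
lemma TraceIneq.eLpNorm_le {Ω D : Set (E d)} (h : TraceIneq Ω (frontier D)) :
    ∃ C : ℝ≥0∞, C ≠ ⊤ ∧ ∀ φ : E d → ℂ, ContDiff ℝ ∞ φ → eLpNorm φ 2 (surf D)
      ≤ C * (eLpNorm φ 2 (volume.restrict Ω) + eLpNorm (grad φ) 2 (volume.restrict Ω)) := by
  obtain ⟨C, hC, h⟩ := h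
  refine ⟨1 + C, by finiteness, fun φ hφ => le_of_sq_le_mul_sq_add ?_⟩
  simp only [eLpNorm_two_sq]
  exact h φ hφ

/-- The trace on `∂D` is bounded with respect to the `H¹(Ω)` norm. In particular it is unique. -/
lemma exists_trace_bound {Ω D : Set (E d)} (h : TraceIneq Ω (frontier D)) :
    ∃ C : ℝ, 0 ≤ C ∧ ∀ (u : H1 Ω) (τ : L2b D), IsTrace D u τ → ‖τ‖ ≤ C * ‖u‖ := by
  obtain ⟨C, hC, h⟩ := h.eLpNorm_le
  refine ⟨(C * 2).toReal, ENNReal.toReal_nonneg, ?_⟩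
  rintro u τ ⟨φ, hφ, a1, a2, a3⟩
  have key : ∀ n, ‖τ‖ₑ ≤ eLpNorm (fun x => φ n x - τ x) 2 (surf D)
      + C * ((eLpNorm (fun x => φ n x - H1fn u x) 2 (volume.restrict Ω) + ‖H1fn u‖ₑ)
        + (eLpNorm (fun x => grad (φ n) x - H1grad u x) 2 (volume.restrict Ω) + ‖H1grad u‖ₑ)) := by
    intro n
    refine (enorm_le_sub_add (hφ n).continuous.aestronglyMeasurable τ).trans ?_
    refine add_le_add_right ((h _ (hφ n)).trans (mul_le_mul_right (add_le_add ?_ ?_) _)) _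
    · exact eLpNorm_le_sub_add (hφ n).continuous.aestronglyMeasurable _
    · exact eLpNorm_le_sub_add (continuous_grad (hφ n)).aestronglyMeasurable _
  have lim := a3.add (ENNReal.Tendsto.const_mul
    ((a1.add (tendsto_const_nhds (x := ‖H1fn u‖ₑ))).add
      (a2.add (tendsto_const_nhds (x := ‖H1grad u‖ₑ)))) (Or.inr hC))
  have h1 := ge_of_tendsto' lim key
  simp only [zero_add] at h1
  have h2 : ‖τ‖ₑ ≤ C * 2 * ‖u‖ₑ := by
    refine h1.trans ?_
    rw [mul_assoc, two_mul]
    gcongr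
    · exact enorm_le_iff_norm_le.2 (norm_H1fn_le u)
    · exact enorm_le_iff_norm_le.2 (norm_H1grad_le u)
  have h3 := ENNReal.toReal_mono (by finiteness) h2
  rwa [ENNReal.toReal_mul, toReal_enorm, toReal_enorm] at h3

/-- The Friedrichs inequality on `H¹₀(Ω)`. -/
lemma exists_friedrichs_bound {Ω : Set (E d)} (hd : 0 < d) (ho : IsOpen Ω)
    (hb : Bornology.IsBounded Ω) :
    ∃ C : ℝ, 0 ≤ C ∧ ∀ u : H1 Ω, IsTrace Ω u 0 → ‖H1fn u‖ ≤ C * ‖H1grad u‖ := by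
  obtain ⟨C, hC, h⟩ := friedrichs hd ho hb
  refine ⟨(1 + C).toReal, ENNReal.toReal_nonneg, ?_⟩
  rintro u ⟨φ, hφ, a1, a2, a3⟩
  have key : ∀ n, ‖H1fn u‖ₑ ≤ eLpNorm (fun x => φ n x - H1fn u x) 2 (volume.restrict Ω)
      + (1 + C) * ((eLpNorm (fun x => grad (φ n) x - H1grad u x) 2 (volume.restrict Ω)
        + ‖H1grad u‖ₑ) + (eLpNorm (fun x => φ n x - (0 : L2b Ω) x) 2 (surf Ω)
          + ‖(0 : L2b Ω)‖ₑ)) := by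
    intro n
    refine (enorm_le_sub_add (hφ n).continuous.aestronglyMeasurable (H1fn u)).trans ?_
    refine add_le_add_right (le_trans (le_of_sq_le_mul_sq_add
      (a := eLpNorm (grad (φ n)) 2 (volume.restrict Ω)) (b := eLpNorm (φ n) 2 (surf Ω)) ?_)
      (mul_le_mul_right (add_le_add ?_ ?_) _)) _
    · simp only [eLpNorm_two_sq]
      exact h _ (hφ n)
    · exact eLpNorm_le_sub_add (continuous_grad (hφ n)).aestronglyMeasurable _
    · exact eLpNorm_le_sub_add (hφ n).continuous.aestronglyMeasurable _
  have hC1 : 1 + C ≠ ⊤ := by finiteness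
  have lim := a1.add (ENNReal.Tendsto.const_mul
    ((a2.add (tendsto_const_nhds (x := ‖H1grad u‖ₑ))).add
      (a3.add (tendsto_const_nhds (x := ‖(0 : L2b Ω)‖ₑ)))) (Or.inr hC1))
  have h1 := ge_of_tendsto' lim key
  simp only [zero_add, enorm_zero, add_zero] at h1
  have h3 := ENNReal.toReal_mono (by finiteness) h1
  rwa [ENNReal.toReal_mul, toReal_enorm, toReal_enorm] at h3

/-- Every `u` which is approximable by smooth functions, as witnessed by a trace on any boundary,
has a trace on `∂D`. -/
lemma exists_isTrace {Ω D s : Set (E d)} (h : TraceIneq Ω (frontier D))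
    (hb : Bornology.IsBounded Ω) (hc : IsCompact (frontier D)) {u : H1 Ω} {σ : L2b s}
    (hu : IsTrace s u σ) : ∃ τ : L2b D, IsTrace D u τ := by
  have hfin := h.measure_lt_top hb
  obtain ⟨C, hC, h⟩ := h.eLpNorm_le
  obtain ⟨φ, hφ, a1, a2, -⟩ := hu
  have hm : ∀ n, MemLp (φ n) 2 (surf D) := fun n =>
    memLp_of_continuous (hφ n).continuous hc.measurableSet hc.isBounded hfin
  set c : ℕ → ℝ≥0∞ := fun n => C * (eLpNorm (fun x => φ n x - H1fn u x) 2 (volume.restrict Ω)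
    + eLpNorm (fun x => grad (φ n) x - H1grad u x) 2 (volume.restrict Ω)) with hcdef
  have hclim : Tendsto c atTop (𝓝 0) := by
    have := ENNReal.Tendsto.const_mul (a1.add a2) (Or.inr hC)
    simpa using this
  have hed : ∀ n m, edist (hm n).toLp (hm m).toLp ≤ c n + c m := by
    intro n m
    rw [Lp.edist_toLp_toLp]
    have hsm : ContDiff ℝ ∞ (φ n - φ m) := (hφ n).sub (hφ m)
    have hgr : grad (φ n - φ m) = fun x => grad (φ n) x - grad (φ m) x := by
      ext1 x
      have := grad_lin (hφ m) (hφ n) (-1) x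
      have e : (fun y => -1 * φ m y + φ n y) = φ n - φ m := by ext y; simp; ring
      rw [e] at this
      rw [this]
      simp [sub_eq_neg_add]
    refine (h _ hsm).trans ?_
    rw [hcdef]
    dsimp only
    rw [← mul_add, hgr]
    refine mul_le_mul_right ?_ _
    calc _ ≤ (eLpNorm (fun x => φ n x - H1fn u x) 2 (volume.restrict Ω)
          + eLpNorm (fun x => φ m x - H1fn u x) 2 (volume.restrict Ω))
        + (eLpNorm (fun x => grad (φ n) x - H1grad u x) 2 (volume.restrict Ω)
          + eLpNorm (fun x => grad (φ m) x - H1grad u x) 2 (volume.restrict Ω)) := by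
          refine add_le_add ?_ ?_
          · refine le_trans (le_of_eq ?_) (eLpNorm_sub_le
              ((hφ n).continuous.aestronglyMeasurable.sub (Lp.aestronglyMeasurable (H1fn u)))
              ((hφ m).continuous.aestronglyMeasurable.sub (Lp.aestronglyMeasurable (H1fn u)))
              (by norm_num))
            congr 1; ext1 x; simp
          · refine le_trans (le_of_eq ?_) (eLpNorm_sub_le
              ((continuous_grad (hφ n)).aestronglyMeasurable.sub
                (Lp.aestronglyMeasurable (H1grad u)))
              ((continuous_grad (hφ m)).aestronglyMeasurable.sub
                (Lp.aestronglyMeasurable (H1grad u)))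
              (by norm_num))
            congr 1; ext1 x; simp
      _ = _ := by ring
  have hcau : CauchySeq fun n => (hm n).toLp := by
    rw [EMetric.cauchySeq_iff]
    intro ε hε
    obtain ⟨N, hN⟩ := eventually_atTop.1
      (hclim.eventually (gt_mem_nhds (ENNReal.half_pos hε.ne')))
    refine ⟨N, fun m hm' n hn => (hed m n).trans_lt ?_⟩
    calc c m + c n < ε / 2 + ε / 2 := ENNReal.add_lt_add (hN m hm') (hN n hn)
      _ = ε := ENNReal.add_halves ε
  obtain ⟨τ, hτ⟩ := cauchySeq_tendsto_of_complete hcau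
  refine ⟨τ, φ, hφ, a1, a2, ?_⟩
  rw [tendsto_iff_edist_tendsto_0] at hτ
  refine hτ.congr fun n => ?_
  rw [Lp.edist_def]
  refine eLpNorm_congr_ae ?_
  filter_upwards [(hm n).coeFn_toLp] with x hx
  simp [hx]

lemma exists_cutoff {s t : Set (E d)} (hs : IsClosed s) (ht : IsClosed t) (hd : Disjoint s t) :
    ∃ χ : E d → ℝ, ContDiff ℝ ∞ χ ∧ (∀ x, |χ x| ≤ 1) ∧ (∀ x ∈ s, χ x = 0) ∧ ∀ x ∈ t, χ x = 1 := by
  obtain ⟨χ, h0, h1, h2⟩ := exists_contMDiffMap_zero_one_of_isClosed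
    (modelWithCornersSelf ℝ (E d)) (n := ⊤) hs ht hd
  refine ⟨χ, χ.contMDiff.contDiff, fun x => ?_, fun x hx => h0 hx, fun x hx => h1 hx⟩
  rw [abs_of_nonneg (h2 x).1]
  exact (h2 x).2

/-- A function vanishing near `∂D` has trace zero on `∂D`. -/
lemma trace_eq_zero_of_near {Ω D V : Set (E d)} (h : TraceIneq Ω (frontier D)) (hΩ : IsOpen Ω)
    (hb : Bornology.IsBounded Ω) (hV : IsOpen V) (hDV : frontier D ⊆ V) {u : H1 Ω} {τ : L2b D}
    (hu : IsTrace D u τ) (hu0 : ∀ᵐ x ∂(volume.restrict (Ω ∩ V)), H1fn u x = 0) : τ = 0 := by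
  obtain ⟨χ, hχ, hχ1, hχs, hχt⟩ := exists_cutoff hV.isClosed_compl (isClosed_frontier (s := D))
    (disjoint_compl_left_iff_subset.2 hDV)
  obtain ⟨v, hv, hv'⟩ := exists_H1_mul hΩ hb hχ u
  have hτ : IsTrace D v τ := by
    refine hu.mul hΩ hb hχ hχ1 hv hv' ?_
    filter_upwards [ae_restrict_mem (isClosed_frontier (s := D)).measurableSet] with x hx
    simp [hχt x hx]
  have hv0 : v = 0 := by
    refine H1_eq_zero hΩ hb ?_
    have hu1 : ∀ᵐ x ∂(volume.restrict Ω), x ∈ V → H1fn u x = 0 := by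
      rw [← ae_restrict_iff' hV.measurableSet, Measure.restrict_restrict hV.measurableSet,
        inter_comm]
      exact hu0
    filter_upwards [hv, hu1] with x hx hx1
    rw [hx, Pi.zero_apply]
    by_cases hxV : x ∈ V
    · rw [hx1 hxV, mul_zero]
    · rw [hχs x hxV, Complex.ofReal_zero, zero_mul]
  obtain ⟨C, -, hC⟩ := exists_trace_bound h
  have := hC v τ hτ
  rw [hv0, norm_zero, mul_zero] at this
  exact norm_le_zero_iff.1 this

/-- Boundary values on `∂Ω` can be lifted to functions vanishing near a compact subset of `Ω`. -/
lemma exists_lift_vanishing {Ω K : Set (E d)} (hΩ : IsOpen Ω) (hb : Bornology.IsBounded Ω)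
    (hK : IsClosed K) (hd : Disjoint K (frontier Ω)) {u : H1 Ω} {τ : L2b Ω}
    (hu : IsTrace Ω u τ) : ∃ v : H1 Ω, IsTrace Ω v τ ∧ ∃ V : Set (E d), IsOpen V ∧ K ⊆ V ∧
      ∀ᵐ x ∂(volume.restrict (Ω ∩ V)), H1fn v x = 0 := by
  obtain ⟨V, hV, hKV, hVs⟩ := normal_exists_closure_subset hK
    (isClosed_frontier (s := Ω)).isOpen_compl (subset_compl_iff_disjoint_right.2 hd)
  obtain ⟨χ, hχ, hχ1, hχs, hχt⟩ := exists_cutoff (isClosed_closure (s := V))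
    (isClosed_frontier (s := Ω)) (subset_compl_iff_disjoint_right.1 hVs)
  obtain ⟨v, hv, hv'⟩ := exists_H1_mul hΩ hb hχ u
  refine ⟨v, ?_, V, hV, hKV, ?_⟩
  · refine hu.mul hΩ hb hχ hχ1 hv hv' ?_
    filter_upwards [ae_restrict_mem (isClosed_frontier (s := Ω)).measurableSet] with x hx
    simp [hχt x hx]
  · filter_upwards [ae_restrict_of_ae_restrict_of_subset inter_subset_left hv,
      ae_restrict_mem (hΩ.inter hV).measurableSet] with x hx hxV
    rw [hx, hχs x (subset_closure hxV.2), Complex.ofReal_zero, zero_mul]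

/-! ### Solution operators for coercive problems on a subspace -/

section Abstract

variable {X : Type*} [NormedAddCommGroup X] [InnerProductSpace ℂ X]

lemma eq_zero_of_coercive {X₀ : Submodule ℂ X} {B : X →L[ℂ] X} {c : ℝ}
    (hc : 0 < c) (hB : ∀ x ∈ X₀, c * ‖x‖ ^ 2 ≤ (inner ℂ x (B x)).re) {x : X} (hx : x ∈ X₀)
    (h : ∀ φ ∈ X₀, inner ℂ φ (B x) = 0) : x = 0 := by
  have h1 := hB x hx
  rw [h x hx, Complex.zero_re] at h1
  have h2 : ‖x‖ ^ 2 ≤ 0 := by nlinarith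
  exact norm_eq_zero.1 (pow_eq_zero_iff two_ne_zero |>.1 (le_antisymm h2 (sq_nonneg _)))

/-- The uniqueness behind all the boundary value problems. -/
lemma eq_of_coercive {X₀ : Submodule ℂ X} {B : X →L[ℂ] X} {c : ℝ}
    (hc : 0 < c) (hB : ∀ x ∈ X₀, c * ‖x‖ ^ 2 ≤ (inner ℂ x (B x)).re) {p q : X} (hpq : p - q ∈ X₀)
    (h : ∀ φ ∈ X₀, inner ℂ φ (B p) = inner ℂ φ (B q)) : p = q := by
  refine sub_eq_zero.1 (eq_zero_of_coercive hc hB hpq fun φ hφ => ?_)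
  rw [map_sub, inner_sub_right, h φ hφ, sub_self]

variable [CompleteSpace X]

/-- Lax–Milgram on a closed subspace: the solution operator of `⟪φ, B y⟫ = ⟪φ, x⟫` for all `φ` in
the subspace, with `y` in the subspace. -/
lemma exists_solution_operator (X₀ : Submodule ℂ X) [CompleteSpace X₀] (B : X →L[ℂ] X) {c : ℝ}
    (hc : 0 < c) (hB : ∀ x ∈ X₀, c * ‖x‖ ^ 2 ≤ (inner ℂ x (B x)).re) :
    ∃ G : X →L[ℂ] X, (∀ x, G x ∈ X₀) ∧
      ∀ x, ∀ φ ∈ X₀, inner ℂ φ (B (G x)) = inner ℂ φ x := by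
  set J : X₀ →L[ℂ] X := X₀.subtypeL
  set A : X₀ →L[ℂ] X₀ := (J.adjoint).comp (B.comp J) with hA
  have hAi : ∀ x y : X₀, inner ℂ x (A y) = inner ℂ (x : X) (B y) := fun x y => by
    rw [hA]
    exact ContinuousLinearMap.adjoint_inner_right J x (B y)
  have hunit : IsUnit A := by
    refine ContinuousLinearMap.isUnit_of_forall_le_norm_inner_map A (c := ⟨c, hc.le⟩) hc fun x => ?_
    rw [norm_inner_symm, hAi, mul_comm]
    exact (hB x x.2).trans ((le_abs_self _).trans (Complex.abs_re_le_norm _))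
  obtain ⟨a, ha⟩ := hunit
  refine ⟨J.comp ((↑a⁻¹ : X₀ →L[ℂ] X₀).comp J.adjoint), fun x => Subtype.property _,
    fun x φ hφ => ?_⟩
  have h1 : A ((↑a⁻¹ : X₀ →L[ℂ] X₀) (J.adjoint x)) = J.adjoint x := by
    have : (A * (↑a⁻¹ : X₀ →L[ℂ] X₀)) = 1 := by rw [← ha]; exact a.mul_inv
    exact congrArg (fun F : X₀ →L[ℂ] X₀ => F (J.adjoint x)) this
  have h2 := hAi ⟨φ, hφ⟩ ((↑a⁻¹ : X₀ →L[ℂ] X₀) (J.adjoint x))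
  rw [h1, ContinuousLinearMap.adjoint_inner_right] at h2
  exact h2.symm

variable {Y Z : Type*} [NormedAddCommGroup Y] [InnerProductSpace ℂ Y] [CompleteSpace Y]
  [NormedAddCommGroup Z] [InnerProductSpace ℂ Z] [CompleteSpace Z]

/-- The operator of the form `⟪Q φ, Q u⟫ + ⟪R φ, Γ (R u)⟫`. -/
noncomputable def formOp (Q : X →L[ℂ] Y) (R : X →L[ℂ] Z) (Γ : Z →L[ℂ] Z) : X →L[ℂ] X :=
  Q.adjoint.comp Q + R.adjoint.comp (Γ.comp R)

lemma inner_formOp (Q : X →L[ℂ] Y) (R : X →L[ℂ] Z) (Γ : Z →L[ℂ] Z) (φ u : X) :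
    inner ℂ φ (formOp Q R Γ u) = inner ℂ (Q φ) (Q u) + inner ℂ (R φ) (Γ (R u)) := by
  simp [formOp, ContinuousLinearMap.adjoint_inner_right]

lemma formOp_symm {Q : X →L[ℂ] Y} {R : X →L[ℂ] Z} {Γ : Z →L[ℂ] Z}
    (hΓ : ∀ z z', inner ℂ z (Γ z') = inner ℂ (Γ z) z') (φ u : X) :
    inner ℂ φ (formOp Q R Γ u) = inner ℂ (formOp Q R Γ φ) u := by
  rw [inner_formOp, ← inner_conj_symm (formOp Q R Γ φ), inner_formOp, map_add, inner_conj_symm,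
    inner_conj_symm, hΓ]

lemma formOp_coercive {X₀ : Submodule ℂ X} {Q : X →L[ℂ] Y} (R : X →L[ℂ] Z) {Γ : Z →L[ℂ] Z}
    (hΓ : ∀ z, 0 ≤ (inner ℂ z (Γ z)).re) {c : ℝ} (hQ : ∀ x ∈ X₀, c * ‖x‖ ^ 2 ≤ ‖Q x‖ ^ 2) :
    ∀ x ∈ X₀, c * ‖x‖ ^ 2 ≤ (inner ℂ x (formOp Q R Γ x)).re := by
  intro x hx
  rw [inner_formOp, Complex.add_re]
  have h1 : (inner ℂ (Q x) (Q x)).re = ‖Q x‖ ^ 2 := by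
    rw [inner_self_eq_norm_sq_to_K]; norm_cast
  have := hΓ (R x)
  linarith [hQ x hx]

/-- The variational core of the factorization: `u`, `u₀` and `v` solve the homogeneous problems for
the forms with, without and with the term `⟪R φ, Γ (R u)⟫`. -/
lemma formOp_sub_eq {X₀ : Submodule ℂ X} {Q : X →L[ℂ] Y} {R : X →L[ℂ] Z} {Γ : Z →L[ℂ] Z}
    (hΓ : ∀ z z', inner ℂ z (Γ z') = inner ℂ (Γ z) z') {u u₀ v Φ : X}
    (hu : ∀ φ ∈ X₀, inner ℂ φ (formOp Q R Γ u) = 0)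
    (hu₀ : ∀ φ ∈ X₀, inner ℂ φ (formOp Q R 0 u₀) = 0)
    (hv : ∀ φ ∈ X₀, inner ℂ φ (formOp Q R Γ v) = 0) (huu : u - u₀ ∈ X₀) (hΦ : Φ - v ∈ X₀) :
    inner ℂ Φ (formOp Q R Γ u) - inner ℂ Φ (formOp Q R 0 u₀) = inner ℂ (R v) (Γ (R u₀)) := by
  have h1 := hu _ hΦ
  have h2 := hu₀ _ hΦ
  rw [inner_sub_left, sub_eq_zero] at h1 h2
  have h3 : inner ℂ v (formOp Q R Γ (u - u₀)) = 0 := by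
    rw [formOp_symm hΓ, ← inner_conj_symm, hv _ huu, map_zero]
  rw [h1, h2]
  rw [map_sub, inner_sub_right, sub_eq_zero] at h3
  rw [h3]
  simp [inner_formOp]

/-- The solution operator of the homogeneous problem with the boundary values of `L f`. -/
lemma exists_lifted_solution {H : Type*} [SeminormedAddCommGroup H] [NormedSpace ℂ H]
    (X₀ : Submodule ℂ X) [CompleteSpace X₀] (B : X →L[ℂ] X) {c : ℝ}
    (hc : 0 < c) (hB : ∀ x ∈ X₀, c * ‖x‖ ^ 2 ≤ (inner ℂ x (B x)).re) (L : H →L[ℂ] X) :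
    ∃ U : H →L[ℂ] X, (∀ f, L f - U f ∈ X₀) ∧ ∀ f, ∀ φ ∈ X₀, inner ℂ φ (B (U f)) = 0 := by
  obtain ⟨G, hGm, hG⟩ := exists_solution_operator X₀ B hc hB
  refine ⟨L - G.comp (B.comp L), fun f => ?_, fun f φ hφ => ?_⟩
  · have : L f - (L - G.comp (B.comp L)) f = G (B (L f)) := sub_sub_cancel _ _
    rw [this]
    exact hGm _
  · have : (L - G.comp (B.comp L)) f = L f - G (B (L f)) := rfl
    rw [this, map_sub, inner_sub_right, hG _ φ hφ, sub_self]

/-- The solution operator of the problem with source `-R† (M z)`. -/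
lemma exists_source_solution (X₀ : Submodule ℂ X) [CompleteSpace X₀] (B : X →L[ℂ] X) {c : ℝ}
    (hc : 0 < c) (hB : ∀ x ∈ X₀, c * ‖x‖ ^ 2 ≤ (inner ℂ x (B x)).re) (R : X →L[ℂ] Z)
    (M : Z →L[ℂ] Z) : ∃ W : Z →L[ℂ] X, (∀ z, W z ∈ X₀) ∧
      ∀ z, ∀ φ ∈ X₀, inner ℂ φ (B (W z)) = inner ℂ φ (-R.adjoint (M z)) := by
  obtain ⟨G, hGm, hG⟩ := exists_solution_operator X₀ B hc hB
  refine ⟨-G.comp (R.adjoint.comp M), fun z => X₀.neg_mem (hGm _), fun z φ hφ => ?_⟩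
  have : (-G.comp (R.adjoint.comp M)) z = -G (R.adjoint (M z)) := rfl
  rw [this, map_neg, inner_neg_right, inner_neg_right, hG _ φ hφ]

/-- The pairing of `R u` with `g` in terms of the solution `v` with source `-R† g`, for `u` a
homogeneous solution with the boundary values of `Φ`: this describes the adjoint of the solution
operator. -/
lemma inner_trace_eq {X₀ : Submodule ℂ X} {Q : X →L[ℂ] Y} {R : X →L[ℂ] Z} {Γ : Z →L[ℂ] Z}
    (hΓ : ∀ z z', inner ℂ z (Γ z') = inner ℂ (Γ z) z') {u v Φ : X} {g : Z}
    (hu : ∀ φ ∈ X₀, inner ℂ φ (formOp Q R Γ u) = 0) (hΦ : Φ - u ∈ X₀) (hv₀ : v ∈ X₀)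
    (hv : ∀ φ ∈ X₀, inner ℂ φ (formOp Q R Γ v + R.adjoint g) = 0) :
    inner ℂ (R u) g = inner ℂ Φ (formOp Q R Γ v + R.adjoint g) := by
  have h1 := hv _ hΦ
  rw [inner_sub_left, sub_eq_zero] at h1
  have h2 : inner ℂ u (formOp Q R Γ v) = 0 := by
    rw [formOp_symm hΓ, ← inner_conj_symm, hu v hv₀, map_zero]
  rw [h1, inner_add_right, h2, zero_add, ContinuousLinearMap.adjoint_inner_right]

/-- The difference of the solutions with and without the term `⟪R φ, Γ (R u)⟫` is the solution of
the source problem with source `R u`. -/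
lemma sub_eq_source_solution {X₀ : Submodule ℂ X} {Q : X →L[ℂ] Y} {R : X →L[ℂ] Z}
    {Γ : Z →L[ℂ] Z} {c : ℝ} (hc : 0 < c) (hQ : ∀ x ∈ X₀, c * ‖x‖ ^ 2 ≤ ‖Q x‖ ^ 2) {u u₀ w : X}
    (hu : ∀ φ ∈ X₀, inner ℂ φ (formOp Q R Γ u) = 0)
    (hu₀ : ∀ φ ∈ X₀, inner ℂ φ (formOp Q R 0 u₀) = 0) (huu : u - u₀ ∈ X₀) (hw₀ : w ∈ X₀)
    (hw : ∀ φ ∈ X₀, inner ℂ φ (formOp Q R 0 w) = inner ℂ φ (-R.adjoint (Γ (R u)))) :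
    u - u₀ = w := by
  refine eq_of_coercive hc (formOp_coercive R (Γ := 0) (by simp) hQ) (X₀.sub_mem huu hw₀)
    fun φ hφ => ?_
  have h1 := hu φ hφ
  rw [inner_formOp] at h1
  rw [hw φ hφ, map_sub, inner_sub_right, hu₀ φ hφ, sub_zero, inner_neg_right,
    ContinuousLinearMap.adjoint_inner_right, inner_formOp]
  simpa using eq_neg_iff_add_eq_zero.2 h1

end Abstract

/-! ### The trace graph space -/

/-- The graph `{(u, u|_{∂D})}` of the trace operator on `∂D`, with the graph norm. -/
def traceGraph (Ω D : Set (E d)) : Submodule ℂ (WithLp 2 (H1 Ω × L2b D)) where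
  carrier := {p | IsTrace D p.fst p.snd}
  zero_mem' := IsTrace.zero D
  add_mem' hp hq := IsTrace.add hp hq
  smul_mem' c _ hp := IsTrace.smul c hp

-- Instance shortcuts for the nested products and submodules.
-- Shortcuts: without them the search for the next instance runs out of its budget.
noncomputable instance (Ω : Set (E d)) : InnerProductSpace ℂ (H1 Ω) := inferInstance

noncomputable instance (Ω D : Set (E d)) : InnerProductSpace ℂ (WithLp 2 (H1 Ω × L2b D)) :=
  inferInstance

/-- The trace graph as a Hilbert space. This is a type of its own, so that instance search does not
have to look through the tower of submodules and products. -/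
def TrSpace (Ω D : Set (E d)) : Type := traceGraph Ω D

noncomputable instance (Ω D : Set (E d)) : NormedAddCommGroup (TrSpace Ω D) :=
  inferInstanceAs (NormedAddCommGroup (traceGraph Ω D))

noncomputable instance (Ω D : Set (E d)) : InnerProductSpace ℂ (TrSpace Ω D) :=
  inferInstanceAs (InnerProductSpace ℂ (traceGraph Ω D))

instance (Ω D : Set (E d)) : CompleteSpace (TrSpace Ω D) := by
  have h : IsClosed (traceGraph Ω D : Set (WithLp 2 (H1 Ω × L2b D))) :=
    (isClosed_isTrace Ω D).preimage (WithLp.prod_continuous_ofLp 2 (H1 Ω) (L2b D))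
  exact h.completeSpace_coe

/-- The first component of the trace graph. -/
noncomputable def toH1 (Ω D : Set (E d)) : TrSpace Ω D →L[ℂ] H1 Ω :=
  ((WithLp.fstL 2 ℂ (H1 Ω) (L2b D)).comp (traceGraph Ω D).subtypeL :
    traceGraph Ω D →L[ℂ] H1 Ω)

/-- The second component of the trace graph, that is, the trace operator on `∂D`. -/
noncomputable def trD (Ω D : Set (E d)) : TrSpace Ω D →L[ℂ] L2b D :=
  ((WithLp.sndL 2 ℂ (H1 Ω) (L2b D)).comp (traceGraph Ω D).subtypeL :
    traceGraph Ω D →L[ℂ] L2b D)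

/-- The gradient on the trace graph. -/
noncomputable def gradT (Ω D : Set (E d)) :
    TrSpace Ω D →L[ℂ] Lp (EuclideanSpace ℂ (Fin d)) 2 ((volume : Measure (E d)).restrict Ω) :=
  (gradL Ω).comp (toH1 Ω D)

lemma gradT_apply {Ω D : Set (E d)} (p : TrSpace Ω D) : gradT Ω D p = H1grad (toH1 Ω D p) := rfl

lemma isTrace_trD {Ω D : Set (E d)} (p : TrSpace Ω D) : IsTrace D (toH1 Ω D p) (trD Ω D p) := p.2

lemma exists_trSpace {Ω D : Set (E d)} {u : H1 Ω} {τ : L2b D} (h : IsTrace D u τ) :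
    ∃ p : TrSpace Ω D, toH1 Ω D p = u ∧ trD Ω D p = τ := ⟨⟨WithLp.toLp 2 (u, τ), h⟩, rfl, rfl⟩

lemma trSpace_norm_sq {Ω D : Set (E d)} (p : TrSpace Ω D) :
    ‖p‖ ^ 2 = ‖toH1 Ω D p‖ ^ 2 + ‖trD Ω D p‖ ^ 2 :=
  WithLp.prod_norm_sq_eq_of_L2 (p : traceGraph Ω D).1

lemma IsTrace.sub_zero {Ω s : Set (E d)} {u v : H1 Ω} {τ : L2b s} (hu : IsTrace s u τ)
    (hv : IsTrace s v τ) : IsTrace s (u - v) 0 := by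
  have h := hu.add (hv.smul (-1))
  rwa [neg_one_smul ℂ v, neg_one_smul ℂ τ, ← sub_eq_add_neg, add_neg_cancel] at h

/-- The elements of the trace graph with zero trace on `∂Ω`. -/
def TrSpace₀ (Ω D : Set (E d)) : Submodule ℂ (TrSpace Ω D) where
  carrier := {p | IsTrace Ω (toH1 Ω D p) 0}
  zero_mem' := by
    rw [mem_ofPred_eq, map_zero]
    exact IsTrace.zero Ω
  add_mem' {p q} hp hq := by
    have := IsTrace.add hp hq
    rw [add_zero] at this
    rwa [mem_ofPred_eq, map_add]
  smul_mem' c p hp := by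
    have := IsTrace.smul c hp
    rw [smul_zero] at this
    rwa [mem_ofPred_eq, map_smul]

lemma mem_trSpace₀ {Ω D : Set (E d)} {p : TrSpace Ω D} :
    p ∈ TrSpace₀ Ω D ↔ IsTrace Ω (toH1 Ω D p) 0 := Iff.rfl

lemma sub_mem_trSpace₀ {Ω D : Set (E d)} {p q : TrSpace Ω D} {τ : L2b Ω}
    (hp : IsTrace Ω (toH1 Ω D p) τ) (hq : IsTrace Ω (toH1 Ω D q) τ) : p - q ∈ TrSpace₀ Ω D := by
  rw [mem_trSpace₀, map_sub]
  exact hp.sub_zero hq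

instance (Ω D : Set (E d)) : CompleteSpace (TrSpace₀ Ω D) := by
  have h : IsClosed (TrSpace₀ Ω D : Set (TrSpace Ω D)) := (isClosed_isTrace Ω Ω).preimage
    ((toH1 Ω D).continuous.prodMk (continuous_const (y := (0 : L2b Ω))))
  exact h.completeSpace_coe

/-- Multiplication by a bounded real function on `L²`. -/
lemma exists_mulOp {α : Type*} [MeasurableSpace α] {μ : Measure α} {γ : α → ℝ}
    (hγm : AEStronglyMeasurable γ μ) {C : ℝ} (hC : ∀ᵐ x ∂μ, |γ x| ≤ C) :
    ∃ Γ : Lp ℂ 2 μ →L[ℂ] Lp ℂ 2 μ, ∀ z, Γ z =ᵐ[μ] fun x => (γ x : ℂ) * z x := by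
  have hle : ∀ z : Lp ℂ 2 μ, ∀ᵐ x ∂μ, ‖(γ x : ℂ) * z x‖ ≤ C * ‖z x‖ := fun z => by
    filter_upwards [hC] with x hx
    rw [norm_mul]
    refine mul_le_mul_of_nonneg_right ?_ (norm_nonneg _)
    simpa using hx
  have hm : ∀ z : Lp ℂ 2 μ, MemLp (fun x => (γ x : ℂ) * z x) 2 μ := fun z =>
    (Lp.memLp z).of_le_mul ((Complex.continuous_ofReal.comp_aestronglyMeasurable hγm).mul
      (Lp.aestronglyMeasurable z)) (hle z)
  let L : Lp ℂ 2 μ →ₗ[ℂ] Lp ℂ 2 μ :=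
    { toFun := fun z => (hm z).toLp
      map_add' := fun z z' => by
        ext1
        filter_upwards [(hm z).coeFn_toLp, (hm z').coeFn_toLp, (hm (z + z')).coeFn_toLp,
          Lp.coeFn_add z z', Lp.coeFn_add ((hm z).toLp) ((hm z').toLp)] with x h1 h2 h3 h4 h5
        rw [h3, h5, Pi.add_apply, h1, h2, h4, Pi.add_apply, mul_add]
      map_smul' := fun c z => by
        ext1
        filter_upwards [(hm z).coeFn_toLp, (hm (c • z)).coeFn_toLp, Lp.coeFn_smul c z,
          Lp.coeFn_smul c ((hm z).toLp)] with x h1 h2 h3 h4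
        rw [h2, RingHom.id_apply, h4, Pi.smul_apply, h1, h3, Pi.smul_apply, smul_eq_mul,
          smul_eq_mul]
        ring }
  refine ⟨L.mkContinuous C fun z => ?_, fun z => (hm z).coeFn_toLp⟩
  refine Lp.norm_le_mul_norm_of_ae_le_mul ?_
  filter_upwards [hle z, (hm z).coeFn_toLp] with x h1 h2
  change ‖(hm z).toLp _ x‖ ≤ _
  rw [h2]
  exact h1

lemma mulOp_symm {α : Type*} [MeasurableSpace α] {μ : Measure α} {γ : α → ℝ}
    {Γ : Lp ℂ 2 μ →L[ℂ] Lp ℂ 2 μ} (hΓ : ∀ z, Γ z =ᵐ[μ] fun x => (γ x : ℂ) * z x)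
    (z z' : Lp ℂ 2 μ) : inner ℂ z (Γ z') = inner ℂ (Γ z) z' := by
  rw [L2.inner_def, L2.inner_def]
  refine integral_congr_ae ?_
  filter_upwards [hΓ z, hΓ z'] with x h1 h2
  rw [h1, h2]
  simp only [RCLike.inner_apply, map_mul, Complex.conj_ofReal]
  ring

lemma mulOp_nonneg {α : Type*} [MeasurableSpace α] {μ : Measure α} {γ : α → ℝ}
    {Γ : Lp ℂ 2 μ →L[ℂ] Lp ℂ 2 μ} (hΓ : ∀ z, Γ z =ᵐ[μ] fun x => (γ x : ℂ) * z x)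
    (hγ : ∀ᵐ x ∂μ, 0 ≤ γ x) (z : Lp ℂ 2 μ) : 0 ≤ (inner ℂ z (Γ z)).re := by
  rw [L2.inner_def]
  have h := integral_re (𝕜 := ℂ) (L2.integrable_inner (𝕜 := ℂ) z (Γ z))
  refine le_of_le_of_eq (integral_nonneg_of_ae ?_) h
  filter_upwards [hΓ z, hγ] with x h1 h2
  rw [h1, RCLike.inner_apply, mul_assoc, Complex.mul_conj, ← Complex.ofReal_mul]
  exact mul_nonneg h2 (Complex.normSq_nonneg _)

/-! ### The boundary value problems in the trace graph -/

lemma dirichlet_eq {Ω : Set (E d)} (u φ : H1 Ω) :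
    dirichlet Ω u φ = inner ℂ (H1grad φ) (H1grad u) := by
  rw [L2.inner_def]; rfl

/-- The consequences of the geometric assumptions on `Ω` and `D`. -/
structure Admissible (Ω D : Set (E d)) : Prop where
  open_Ω : IsOpen Ω
  bounded_Ω : Bornology.IsBounded Ω
  open_D : IsOpen D
  closure_subset : closure D ⊆ Ω
  traceIneq : TraceIneq Ω (frontier D)
  volume_frontier : volume (frontier D) = 0
  friedrichs : ∃ C : ℝ, 0 ≤ C ∧ ∀ u : H1 Ω, IsTrace Ω u 0 → ‖H1fn u‖ ≤ C * ‖H1grad u‖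

lemma admissible {Ω D : Set (E d)} (hd : 0 < d) (hΩo : IsOpen Ω) (hΩb : Bornology.IsBounded Ω)
    (hDo : IsOpen D) (hDΩ : D ⊆ Ω) (hDC : HasC2Boundary D)
    (hdist : ∃ δ > 0, ∀ x ∈ frontier Ω, ∀ y ∈ closure D, δ ≤ dist x y) : Admissible Ω D := by
  have hcl : closure D ⊆ Ω := by
    intro x hx
    by_contra hxΩ
    obtain ⟨δ, hδ, h⟩ := hdist
    have hf : x ∈ frontier Ω := by
      rw [hΩo.frontier_eq]; exact ⟨closure_mono hDΩ hx, hxΩ⟩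
    have := h x hf x hx
    rw [dist_self] at this
    linarith
  have hc : IsCompact (frontier D) := (hΩb.subset hDΩ).isCompact_closure.of_isClosed_subset
    isClosed_frontier frontier_subset_closure
  have hT := traceIneq_frontier hΩo hDo hDC hc (frontier_subset_closure.trans hcl)
  exact ⟨hΩo, hΩb, hDo, hcl, hT, hT.volume_eq_zero hd hΩb, exists_friedrichs_bound hd hΩo hΩb⟩

namespace Admissible

variable {Ω D : Set (E d)} (H : Admissible Ω D)
include H

lemma isCompact_frontier : IsCompact (frontier D) :=
  (H.bounded_Ω.subset (subset_closure.trans H.closure_subset)).isCompact_closure.of_isClosed_subset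
    isClosed_frontier frontier_subset_closure

lemma exists_mem_trSpace {u : H1 Ω} {s : Set (E d)} {σ : L2b s} (h : IsTrace s u σ) :
    ∃ p : TrSpace Ω D, toH1 Ω D p = u := by
  obtain ⟨τ, hτ⟩ := exists_isTrace H.traceIneq H.bounded_Ω H.isCompact_frontier h
  obtain ⟨p, hp, -⟩ := exists_trSpace hτ
  exact ⟨p, hp⟩

lemma trace_unique {u : H1 Ω} {τ σ : L2b D} (h : IsTrace D u τ) (h' : IsTrace D u σ) : τ = σ := by
  obtain ⟨C, -, hC⟩ := exists_trace_bound H.traceIneq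
  have h1 : IsTrace D (0 : H1 Ω) (τ - σ) := by
    have h2 := h.add (h'.smul (-1))
    rwa [neg_one_smul ℂ u, neg_one_smul ℂ σ, ← sub_eq_add_neg, ← sub_eq_add_neg,
      sub_self] at h2
  have h2 := hC _ _ h1
  rw [norm_zero, mul_zero] at h2
  exact sub_eq_zero.1 (norm_le_zero_iff.1 h2)

lemma coercive : ∃ c : ℝ, 0 < c ∧ ∀ p ∈ TrSpace₀ Ω D, c * ‖p‖ ^ 2 ≤ ‖gradT Ω D p‖ ^ 2 := by
  obtain ⟨C, hC0, hC⟩ := exists_trace_bound H.traceIneq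
  obtain ⟨F, hF0, hF⟩ := H.friedrichs
  refine ⟨((1 + C ^ 2) * (1 + F ^ 2))⁻¹, by positivity, fun p hp => ?_⟩
  have h1 := hC _ _ (isTrace_trD p)
  have h2 := hF _ (mem_trSpace₀.1 hp)
  have h3 : ‖trD Ω D p‖ ^ 2 ≤ C ^ 2 * ‖toH1 Ω D p‖ ^ 2 := by
    rw [← mul_pow]; gcongr
  have h4 : ‖H1fn (toH1 Ω D p)‖ ^ 2 ≤ F ^ 2 * ‖H1grad (toH1 Ω D p)‖ ^ 2 := by
    rw [← mul_pow]; gcongr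
  have h5 := H1_norm_sq (toH1 Ω D p)
  change _ ≤ ‖H1grad (toH1 Ω D p)‖ ^ 2
  rw [inv_mul_le_iff₀ (by positivity), trSpace_norm_sq]
  calc ‖toH1 Ω D p‖ ^ 2 + ‖trD Ω D p‖ ^ 2 ≤ (1 + C ^ 2) * ‖toH1 Ω D p‖ ^ 2 := by linarith
    _ ≤ (1 + C ^ 2) * ((1 + F ^ 2) * ‖H1grad (toH1 Ω D p)‖ ^ 2) := by gcongr; linarith
    _ = _ := by ring

/-- The boundary of `D` is a null set, so the jump pairing is minus the Dirichlet form on `Ω`. -/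
lemma conormal_jump (u φ : H1 Ω) : conormalPlus D u φ - conormalMinus D u φ
    = -inner ℂ (H1grad φ) (H1grad u) := by
  have hi : IntegrableOn (fun x => inner ℂ (H1grad φ x) (H1grad u x)) Ω :=
    L2.integrable_inner (𝕜 := ℂ) (H1grad φ) (H1grad u)
  have h1 : dirichlet Ω u φ = dirichlet (Ω \ closure D) u φ + dirichlet D u φ := by
    have hdj : Disjoint (Ω \ closure D) D := disjoint_sdiff_left.mono_right subset_closure
    unfold dirichlet
    rw [← setIntegral_union hdj H.open_D.measurableSet (hi.mono_set sdiff_subset)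
      (hi.mono_set (subset_closure.trans H.closure_subset))]
    refine setIntegral_congr_set ?_
    have hae : ∀ᵐ x ∂(volume : Measure (E d)), x ∉ frontier D :=
      measure_eq_zero_iff_ae_notMem.1 H.volume_frontier
    filter_upwards [hae] with x hx
    rw [H.open_D.frontier_eq] at hx
    refine propext ⟨fun h => ?_, fun h => h.elim (fun h => h.1) fun h =>
      H.closure_subset (subset_closure h)⟩
    by_cases hxc : x ∈ closure D
    · exact Or.inr (by by_contra hxD; exact hx ⟨hxc, hxD⟩)
    · exact Or.inl ⟨h, hxc⟩
  rw [conormalPlus, conormalMinus, ← dirichlet_eq, h1]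
  ring

/-- The jump problem is equivalent to its variational formulation. -/
lemma solvesJump_iff {u : H1 Ω} {q : E d → ℂ} {z : L2b D} (hq : z =ᵐ[surf D] q) :
    SolvesJump D u q ↔ ∀ p ∈ TrSpace₀ Ω D,
      inner ℂ (gradT Ω D p) (H1grad u) = -inner ℂ (trD Ω D p) z := by
  have hz : ∀ ψ : L2b D, ∫ x, q x * starRingEnd ℂ (ψ x) ∂(surf D) = inner ℂ ψ z := by
    intro ψ
    rw [L2.inner_def]
    refine integral_congr_ae ?_
    filter_upwards [hq] with x hx
    rw [hx]; rfl
  constructor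
  · rintro ⟨-, h⟩ p hp
    have := h (toH1 Ω D p) hp (trD Ω D p) (isTrace_trD p)
    rw [H.conormal_jump, hz] at this
    rw [← this, neg_neg]
    rfl
  · intro h
    refine ⟨fun φ hφ hc hs => ?_, fun φ hφ ψ hψ => ?_⟩
    · obtain ⟨v, hv, hv'⟩ := exists_H1_smooth H.open_Ω H.bounded_Ω hφ
      have hout : ∀ x, x ∉ Ω \ frontier D → φ x = 0 := fun x hx =>
        image_eq_zero_of_notMem_tsupport fun hx' => hx (hs hx')
      have t1 : IsTrace Ω v (0 : L2b Ω) := by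
        refine isTrace_of_smooth hφ hv hv' ?_
        filter_upwards [Lp.coeFn_zero ℂ 2 (surf Ω),
          ae_restrict_mem (isClosed_frontier (s := Ω)).measurableSet] with x hx hxf
        rw [hx, Pi.zero_apply, hout x fun h => ?_]
        rw [H.open_Ω.frontier_eq] at hxf
        exact hxf.2 h.1
      have t2 : IsTrace D v (0 : L2b D) := by
        refine isTrace_of_smooth hφ hv hv' ?_
        filter_upwards [Lp.coeFn_zero ℂ 2 (surf D),
          ae_restrict_mem (isClosed_frontier (s := D)).measurableSet] with x hx hxf
        rw [hx, Pi.zero_apply, hout x fun h => h.2 hxf]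
      obtain ⟨p, hp, hp'⟩ := exists_trSpace t2
      have := h p (mem_trSpace₀.2 (hp ▸ t1))
      rw [hp', inner_zero_left, neg_zero, L2.inner_def] at this
      rw [← this]
      refine integral_congr_ae ?_
      filter_upwards [hv'] with x hx
      have e : gradT Ω D p = H1grad v := by rw [gradT_apply, hp]
      rw [e, hx]
    · obtain ⟨p, hp, hp'⟩ := exists_trSpace hψ
      have := h p (mem_trSpace₀.2 (hp ▸ hφ))
      rw [H.conormal_jump, hz, ← hp']
      have e : gradT Ω D p = H1grad φ := by rw [gradT_apply, hp]
      rw [← e, this, neg_neg]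

lemma isHarmonicLift_iff {f : HHalf Ω} {p : TrSpace Ω D} :
    IsHarmonicLift Ω f (toH1 Ω D p) ↔ IsTrace Ω (toH1 Ω D p) f.toL2 ∧
      ∀ φ ∈ TrSpace₀ Ω D, inner ℂ φ (formOp (gradT Ω D) (trD Ω D) 0 p) = 0 := by
  refine and_congr_right fun _ => ⟨fun h φ hφ => ?_, fun h φ hφ => ?_⟩
  · have := h (toH1 Ω D φ) hφ
    rw [dirichlet_eq] at this
    rw [inner_formOp]
    simpa [gradT_apply] using this
  · obtain ⟨q, hq⟩ := H.exists_mem_trSpace hφ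
    have := h q (mem_trSpace₀.2 (hq ▸ hφ))
    rw [inner_formOp] at this
    rw [dirichlet_eq, ← hq]
    simpa [gradT_apply] using this

lemma isPotential_iff {γ : E d → ℝ} {Γ : L2b D →L[ℂ] L2b D}
    (hΓ : ∀ z, Γ z =ᵐ[surf D] fun x => (γ x : ℂ) * z x) {f : HHalf Ω} {p : TrSpace Ω D} :
    IsPotential Ω D γ f (toH1 Ω D p) ↔ IsTrace Ω (toH1 Ω D p) f.toL2 ∧
      ∀ φ ∈ TrSpace₀ Ω D, inner ℂ φ (formOp (gradT Ω D) (trD Ω D) Γ p) = 0 := by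
  simp only [inner_formOp]
  refine and_congr_right fun _ => ⟨?_, fun h => ⟨trD Ω D p, isTrace_trD p, ?_⟩⟩
  · rintro ⟨τ, hτ, h⟩ φ hφ
    rw [H.trace_unique hτ (isTrace_trD p)] at h
    exact eq_neg_iff_add_eq_zero.1 ((H.solvesJump_iff (hΓ _)).1 h φ hφ)
  · exact (H.solvesJump_iff (hΓ _)).2 fun φ hφ => eq_neg_iff_add_eq_zero.2 (h φ hφ)

lemma isSourceSol_iff {γ : E d → ℝ} {Γ : L2b D →L[ℂ] L2b D}
    (hΓ : ∀ z, Γ z =ᵐ[surf D] fun x => (γ x : ℂ) * z x) {h : L2b D} {p : TrSpace Ω D} :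
    IsSourceSol Ω D γ h (toH1 Ω D p) ↔ p ∈ TrSpace₀ Ω D ∧
      ∀ φ ∈ TrSpace₀ Ω D, inner ℂ φ (formOp (gradT Ω D) (trD Ω D) 0 p)
        = inner ℂ φ (-(trD Ω D).adjoint (Γ h)) := by
  simp only [inner_formOp, inner_neg_right, ContinuousLinearMap.adjoint_inner_right,
    zero_apply, inner_zero_right, add_zero]
  exact and_congr_right fun _ => H.solvesJump_iff (hΓ h)

lemma isAdjointSol_iff {γ : E d → ℝ} {Γ : L2b D →L[ℂ] L2b D}
    (hΓ : ∀ z, Γ z =ᵐ[surf D] fun x => (γ x : ℂ) * z x) {g : L2b D} {p : TrSpace Ω D} :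
    IsAdjointSol Ω D γ g (toH1 Ω D p) ↔ p ∈ TrSpace₀ Ω D ∧
      ∀ φ ∈ TrSpace₀ Ω D, inner ℂ φ (formOp (gradT Ω D) (trD Ω D) Γ p)
        = inner ℂ φ (-(trD Ω D).adjoint g) := by
  have hq : ∀ τ : L2b D, (Γ τ + g : L2b D) =ᵐ[surf D] fun x => (γ x : ℂ) * τ x + g x := fun τ => by
    filter_upwards [hΓ τ, Lp.coeFn_add (Γ τ) g] with x h1 h2
    rw [h2, Pi.add_apply, h1]
  have hiff : ∀ φ : TrSpace Ω D, inner ℂ φ (formOp (gradT Ω D) (trD Ω D) Γ p)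
        = inner ℂ φ (-(trD Ω D).adjoint g) ↔
      inner ℂ (gradT Ω D φ) (H1grad (toH1 Ω D p)) = -inner ℂ (trD Ω D φ) (Γ (trD Ω D p) + g) := by
    intro φ
    rw [inner_formOp, inner_neg_right, ContinuousLinearMap.adjoint_inner_right, inner_add_right,
      neg_add', eq_sub_iff_add_eq, ← eq_sub_iff_add_eq, ← eq_sub_iff_add_eq, sub_eq_add_neg,
      sub_eq_add_neg, add_comm (-_), add_comm (-_)]
    exact Iff.rfl
  simp only [hiff]
  refine and_congr_right fun _ => ⟨?_, fun h => ⟨trD Ω D p, isTrace_trD p, ?_⟩⟩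
  · rintro ⟨τ, hτ, h⟩
    rw [H.trace_unique hτ (isTrace_trD p)] at h
    exact (H.solvesJump_iff (hq _)).1 h
  · exact (H.solvesJump_iff (hq _)).2 h

lemma potential_unique {γ : E d → ℝ} (hγ : ∀ᵐ x ∂(surf D), 0 ≤ γ x) {Γ : L2b D →L[ℂ] L2b D}
    (hΓ : ∀ z, Γ z =ᵐ[surf D] fun x => (γ x : ℂ) * z x) {f : HHalf Ω} {u u' : H1 Ω}
    (hu : IsPotential Ω D γ f u) (hu' : IsPotential Ω D γ f u') : u = u' := by
  obtain ⟨p, rfl⟩ := H.exists_mem_trSpace hu.1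
  obtain ⟨q, rfl⟩ := H.exists_mem_trSpace hu'.1
  obtain ⟨h1, h2⟩ := (H.isPotential_iff hΓ).1 hu
  obtain ⟨h1', h2'⟩ := (H.isPotential_iff hΓ).1 hu'
  obtain ⟨c, hc, hQ⟩ := H.coercive
  rw [eq_of_coercive hc (formOp_coercive (trD Ω D) (mulOp_nonneg hΓ hγ) hQ)
    (sub_mem_trSpace₀ h1 h1') fun φ hφ => (h2 φ hφ).trans (h2' φ hφ).symm]

lemma harmonicLift_unique {f : HHalf Ω} {u u' : H1 Ω}
    (hu : IsHarmonicLift Ω f u) (hu' : IsHarmonicLift Ω f u') : u = u' := by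
  obtain ⟨p, rfl⟩ := H.exists_mem_trSpace hu.1
  obtain ⟨q, rfl⟩ := H.exists_mem_trSpace hu'.1
  obtain ⟨h1, h2⟩ := H.isHarmonicLift_iff.1 hu
  obtain ⟨h1', h2'⟩ := H.isHarmonicLift_iff.1 hu'
  obtain ⟨c, hc, hQ⟩ := H.coercive
  rw [eq_of_coercive hc (formOp_coercive (trD Ω D) (Γ := 0) (by simp) hQ)
    (sub_mem_trSpace₀ h1 h1') fun φ hφ => (h2 φ hφ).trans (h2' φ hφ).symm]

lemma sourceSol_unique {γ : E d → ℝ} {Γ : L2b D →L[ℂ] L2b D}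
    (hΓ : ∀ z, Γ z =ᵐ[surf D] fun x => (γ x : ℂ) * z x) {h : L2b D} {u u' : H1 Ω}
    (hu : IsSourceSol Ω D γ h u) (hu' : IsSourceSol Ω D γ h u') : u = u' := by
  obtain ⟨p, rfl⟩ := H.exists_mem_trSpace hu.1
  obtain ⟨q, rfl⟩ := H.exists_mem_trSpace hu'.1
  obtain ⟨h1, h2⟩ := (H.isSourceSol_iff hΓ).1 hu
  obtain ⟨h1', h2'⟩ := (H.isSourceSol_iff hΓ).1 hu'
  obtain ⟨c, hc, hQ⟩ := H.coercive
  rw [eq_of_coercive hc (formOp_coercive (trD Ω D) (Γ := 0) (by simp) hQ)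
    ((TrSpace₀ Ω D).sub_mem h1 h1') fun φ hφ => (h2 φ hφ).trans (h2' φ hφ).symm]

lemma adjointSol_unique {γ : E d → ℝ} (hγ : ∀ᵐ x ∂(surf D), 0 ≤ γ x) {Γ : L2b D →L[ℂ] L2b D}
    (hΓ : ∀ z, Γ z =ᵐ[surf D] fun x => (γ x : ℂ) * z x) {g : L2b D} {u u' : H1 Ω}
    (hu : IsAdjointSol Ω D γ g u) (hu' : IsAdjointSol Ω D γ g u') : u = u' := by
  obtain ⟨p, rfl⟩ := H.exists_mem_trSpace hu.1
  obtain ⟨q, rfl⟩ := H.exists_mem_trSpace hu'.1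
  obtain ⟨h1, h2⟩ := (H.isAdjointSol_iff hΓ).1 hu
  obtain ⟨h1', h2'⟩ := (H.isAdjointSol_iff hΓ).1 hu'
  obtain ⟨c, hc, hQ⟩ := H.coercive
  rw [eq_of_coercive hc (formOp_coercive (trD Ω D) (mulOp_nonneg hΓ hγ) hQ)
    ((TrSpace₀ Ω D).sub_mem h1 h1') fun φ hφ => (h2 φ hφ).trans (h2' φ hφ).symm]

/-- A bounded linear lifting of the boundary values on `∂Ω` to the trace graph. -/
lemma exists_lifting : ∃ L : HHalf Ω →L[ℂ] TrSpace Ω D,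
    ∀ f, IsTrace Ω (toH1 Ω D (L f)) f.toL2 := by
  obtain ⟨C, hC0, hC⟩ := exists_trace_bound H.traceIneq
  set P : TrSpace Ω D →L[ℂ] TrSpace Ω D := (TrSpace₀ Ω D)ᗮ.starProjection with hP
  have hex : ∀ f : HHalf Ω, ∃ p : TrSpace Ω D, IsTrace Ω (toH1 Ω D p) f.toL2 := fun f => by
    obtain ⟨u, hu, -⟩ := f.exists_lift one_pos
    obtain ⟨p, rfl⟩ := H.exists_mem_trSpace hu
    exact ⟨p, hu⟩
  choose p hp using hex
  have hker : ∀ {q : TrSpace Ω D}, q ∈ TrSpace₀ Ω D → P q = 0 := fun {q} hq => by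
    rw [hP, Submodule.starProjection_apply_eq_zero_iff]
    exact (Submodule.le_orthogonal_orthogonal _) hq
  have hindep : ∀ {f : HHalf Ω} {q q' : TrSpace Ω D}, IsTrace Ω (toH1 Ω D q) f.toL2 →
      IsTrace Ω (toH1 Ω D q') f.toL2 → P q = P q' := fun {f q q'} h h' => by
    rw [← sub_eq_zero, ← map_sub]
    exact hker (sub_mem_trSpace₀ h h')
  let L : HHalf Ω →ₗ[ℂ] TrSpace Ω D :=
    { toFun := fun f => P (p f)
      map_add' := fun f g => by
        rw [← map_add]
        refine hindep (hp (f + g)) ?_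
        rw [map_add, map_add]
        exact (hp f).add (hp g)
      map_smul' := fun c f => by
        rw [RingHom.id_apply, ← map_smul]
        refine hindep (hp (c • f)) ?_
        rw [map_smul, map_smul]
        exact (hp f).smul c }
  refine ⟨L.mkContinuous (1 + C) fun f => ?_, fun f => ?_⟩
  · refine le_of_forall_pos_le_add fun ε hε => ?_
    obtain ⟨u, hu, hun⟩ := f.exists_lift (ε := ε / (1 + C)) (by positivity)
    obtain ⟨q, rfl⟩ := H.exists_mem_trSpace hu
    have h1 : L f = P q := hindep (hp f) hu
    have h2 : ‖P q‖ ≤ ‖q‖ := Submodule.norm_starProjection_apply_le _ _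
    have h3 : ‖q‖ ≤ (1 + C) * ‖toH1 Ω D q‖ := by
      refine le_of_sq_le_sq ?_ (by positivity)
      have h4 := hC _ _ (isTrace_trD q)
      rw [trSpace_norm_sq]
      nlinarith [norm_nonneg (trD Ω D q), norm_nonneg (toH1 Ω D q),
        mul_nonneg hC0 (sq_nonneg ‖toH1 Ω D q‖)]
    rw [h1]
    calc ‖P q‖ ≤ (1 + C) * ‖toH1 Ω D q‖ := h2.trans h3
      _ ≤ (1 + C) * (‖f‖ + ε / (1 + C)) := by gcongr
      _ = _ := by field_simp
  · change IsTrace Ω (toH1 Ω D (P (p f))) _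
    have h1 : p f - P (p f) ∈ TrSpace₀ Ω D := by
      have : p f - P (p f) = (TrSpace₀ Ω D).starProjection (p f) := by
        rw [hP, Submodule.starProjection_orthogonal_val]
        abel
      rw [this]
      exact Submodule.starProjection_apply_mem _ _
    have h2 := (hp f).add ((mem_trSpace₀.1 h1).smul (-1))
    rwa [smul_zero, add_zero, ← map_smul, ← map_add, neg_one_smul, neg_sub,
      add_sub_cancel] at h2

/-- The Neumann trace is determined by the values on liftings vanishing near the compact set. -/
lemma neumannTrace_unique {K : Set (E d)} (hK : IsClosed K) (hKΩ : K ⊆ Ω) {u : H1 Ω}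
    {ℓ ℓ' : HMinusHalf Ω} (h : IsNeumannTrace K u ℓ) (h' : IsNeumannTrace K u ℓ') : ℓ = ℓ' := by
  ext φ
  obtain ⟨u, hu, -⟩ := φ.exists_lift one_pos
  have hdj : Disjoint K (frontier Ω) := by
    rw [H.open_Ω.frontier_eq]
    exact disjoint_sdiff_right.mono_left hKΩ
  obtain ⟨Φ, hΦ, hV⟩ := exists_lift_vanishing H.open_Ω H.bounded_Ω hK hdj hu
  rw [h φ Φ hΦ hV, h' φ Φ hΦ hV]

/-- A functional given on one lifting by an element orthogonal to the functions with zero trace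
is the Neumann trace. -/
lemma isNeumannTrace_of {L : HHalf Ω →L[ℂ] TrSpace Ω D}
    (hL : ∀ f, IsTrace Ω (toH1 Ω D (L f)) f.toL2) {y u : TrSpace Ω D} {z : L2b D}
    (hy : ∀ φ ∈ TrSpace₀ Ω D, inner ℂ φ y = 0)
    (hyu : ∀ φ, inner ℂ φ y = inner ℂ (gradT Ω D φ) (gradT Ω D u) + inner ℂ (trD Ω D φ) z)
    {ℓ : HMinusHalf Ω} (hℓ : ∀ φ, ℓ φ = inner ℂ (L φ) y) {K : Set (E d)}
    (hK : frontier D ⊆ K ∨ z = 0) : IsNeumannTrace K (toH1 Ω D u) ℓ := by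
  rintro φ Φ hΦ ⟨V, hV, hKV, h0⟩
  obtain ⟨p, rfl⟩ := H.exists_mem_trSpace hΦ
  have h1 := hy _ (sub_mem_trSpace₀ (hL φ) hΦ)
  rw [inner_sub_left, sub_eq_zero] at h1
  rw [hℓ, h1, hyu, dirichlet_eq]
  have h2 : inner ℂ (trD Ω D p) z = 0 := by
    rcases hK with hK | rfl
    · rw [trace_eq_zero_of_near H.traceIneq H.open_Ω H.bounded_Ω hV (hK.trans hKV)
        (isTrace_trD p) h0, inner_zero_left]
    · exact inner_zero_right _
  rw [h2, add_zero]
  rfl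

end Admissible

/-- The conjugate-linear functional `φ ↦ ⟪L φ, y⟫` on the trace space. -/
noncomputable def dualLift {Ω D : Set (E d)} (L : HHalf Ω →L[ℂ] TrSpace Ω D) :
    TrSpace Ω D →L[ℂ] HMinusHalf Ω :=
  ((ContinuousLinearMap.compSL (HHalf Ω) (TrSpace Ω D) ℂ (RingHom.id ℂ) (starRingEnd ℂ)).flip
    L).comp (innerSLFlip ℂ)

end EIT

/-! ### The factorization -/

open EIT
theorem theorem4p2 {d : ℕ} (hd : d = 2 ∨ d = 3) (Ω D : Set (E d))
    (hΩo : IsOpen Ω) (hΩb : Bornology.IsBounded Ω) (hΩs : IsSimplyConnected Ω)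
    (hΩL : HasLipschitzBoundary Ω)
    (hDo : IsOpen D) (hDΩ : D ⊆ Ω) (hDC : HasC2Boundary D)
    (hdist : ∃ δ > 0, ∀ x ∈ frontier Ω, ∀ y ∈ closure D, δ ≤ dist x y)
    (γ : E d → ℝ) (hγm : AEStronglyMeasurable γ (surf D)) (γmin γmax : ℝ) (hγ0 : 0 < γmin)
    (hγ : ∀ᵐ x ∂(surf D), γmin ≤ γ x ∧ γ x ≤ γmax) :
    (∀ f : HHalf Ω, ∃! u : H1 Ω, IsPotential Ω D γ f u) ∧
    (∀ f : HHalf Ω, ∃! u₀ : H1 Ω, IsHarmonicLift Ω f u₀) ∧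
    (∀ h : L2b D, ∃! w : H1 Ω, IsSourceSol Ω D γ h w) ∧
    (∀ g : L2b D, ∃! v : H1 Ω, IsAdjointSol Ω D γ g v) ∧
    ∃ (Λ Λ₀ : HHalf Ω →L[ℂ] HMinusHalf Ω) (S : HHalf Ω →L[ℂ] L2b D) (T : L2b D →L[ℂ] L2b D),
      IsDtN Ω D γ Λ ∧ IsDtN₀ Ω Λ₀ ∧ IsOpS Ω D γ S ∧ IsOpT Ω D γ T ∧
      (∀ (g : L2b D) (ℓ : HMinusHalf Ω), adj S g = ℓ ↔
        ∃ v : H1 Ω, IsAdjointSol Ω D γ g v ∧ IsNeumannTrace (closure D) v ℓ) ∧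
      Λ - Λ₀ = (adj S).comp (T.comp S) := by
  have H : Admissible Ω D := admissible (by omega) hΩo hΩb hDo hDΩ hDC hdist
  obtain ⟨Γ, hΓ⟩ := exists_mulOp hγm (C := γmax) (by
    filter_upwards [hγ] with x hx
    rw [abs_of_nonneg (hγ0.le.trans hx.1)]
    exact hx.2)
  have hγ' : ∀ᵐ x ∂(surf D), 0 ≤ γ x := by
    filter_upwards [hγ] with x hx using hγ0.le.trans hx.1
  have hΓs := mulOp_symm hΓ
  obtain ⟨c, hc, hQ⟩ := H.coercive
  have hB₁ := formOp_coercive (trD Ω D) (mulOp_nonneg hΓ hγ') hQ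
  have hB₀ := formOp_coercive (trD Ω D) (Γ := 0) (by simp) hQ
  obtain ⟨L, hL⟩ := H.exists_lifting
  obtain ⟨U₁, hLU₁, hU₁⟩ := exists_lifted_solution (TrSpace₀ Ω D) _ hc hB₁ L
  obtain ⟨U₀, hLU₀, hU₀⟩ := exists_lifted_solution (TrSpace₀ Ω D) _ hc hB₀ L
  obtain ⟨W, hWm, hW⟩ := exists_source_solution (TrSpace₀ Ω D) _ hc hB₀ (trD Ω D) Γ
  obtain ⟨V, hVm, hV⟩ := exists_source_solution (TrSpace₀ Ω D) _ hc hB₁ (trD Ω D) (.id ℂ _)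
  have hUt : ∀ {f : HHalf Ω} {p : TrSpace Ω D}, L f - p ∈ TrSpace₀ Ω D →
      IsTrace Ω (toH1 Ω D p) f.toL2 := fun {f p} hp => by
    have h := (hL f).add ((TrSpace₀ Ω D).neg_mem hp)
    rwa [add_zero, ← map_add, neg_sub, add_sub_cancel] at h
  have pot : ∀ f, IsPotential Ω D γ f (toH1 Ω D (U₁ f)) := fun f =>
    (H.isPotential_iff hΓ).2 ⟨hUt (hLU₁ f), hU₁ f⟩
  have lift : ∀ f, IsHarmonicLift Ω f (toH1 Ω D (U₀ f)) := fun f =>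
    H.isHarmonicLift_iff.2 ⟨hUt (hLU₀ f), hU₀ f⟩
  have src : ∀ h, IsSourceSol Ω D γ h (toH1 Ω D (W h)) := fun h =>
    (H.isSourceSol_iff hΓ).2 ⟨hWm h, hW h⟩
  have adjs : ∀ g, IsAdjointSol Ω D γ g (toH1 Ω D (V g)) := fun g =>
    (H.isAdjointSol_iff hΓ).2 ⟨hVm g, hV g⟩
  refine ⟨fun f => ⟨_, pot f, fun u hu => H.potential_unique hγ' hΓ hu (pot f)⟩,
    fun f => ⟨_, lift f, fun u hu => H.harmonicLift_unique hu (lift f)⟩,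
    fun h => ⟨_, src h, fun u hu => H.sourceSol_unique hΓ hu (src h)⟩,
    fun g => ⟨_, adjs g, fun u hu => H.adjointSol_unique hγ' hΓ hu (adjs g)⟩,
    (dualLift L).comp ((formOp (gradT Ω D) (trD Ω D) Γ).comp U₁),
    (dualLift L).comp ((formOp (gradT Ω D) (trD Ω D) 0).comp U₀), (trD Ω D).comp U₁,
    Γ - Γ.comp ((trD Ω D).comp W), ?_, ?_, ?_, ?_, ?_, ?_⟩
  · have neu : ∀ f, IsNeumannTrace (closure D) (toH1 Ω D (U₁ f))
        (dualLift L (formOp (gradT Ω D) (trD Ω D) Γ (U₁ f))) := fun f =>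
      H.isNeumannTrace_of hL (hU₁ f) (fun φ => inner_formOp _ _ Γ φ _) (fun φ => rfl)
        (Or.inl frontier_subset_closure)
    refine fun f ℓ => ⟨fun h => ⟨_, pot f, h ▸ neu f⟩, fun ⟨u, hu, hℓ⟩ => ?_⟩
    rw [H.potential_unique hγ' hΓ hu (pot f)] at hℓ
    exact H.neumannTrace_unique isClosed_closure H.closure_subset (neu f) hℓ
  · have neu : ∀ f, IsNeumannTrace ∅ (toH1 Ω D (U₀ f))
        (dualLift L (formOp (gradT Ω D) (trD Ω D) 0 (U₀ f))) := fun f =>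
      H.isNeumannTrace_of hL (hU₀ f) (fun φ => inner_formOp _ _ 0 φ _) (fun φ => rfl) (Or.inr rfl)
    refine fun f ℓ => ⟨fun h => ⟨_, lift f, h ▸ neu f⟩, fun ⟨u, hu, hℓ⟩ => ?_⟩
    rw [H.harmonicLift_unique hu (lift f)] at hℓ
    exact H.neumannTrace_unique isClosed_empty (empty_subset _) (neu f) hℓ
  · refine fun f τ => ⟨fun h => ⟨_, pot f, h ▸ isTrace_trD _⟩, fun ⟨u, hu, hτ⟩ => ?_⟩
    rw [H.potential_unique hγ' hΓ hu (pot f)] at hτ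
    exact H.trace_unique (isTrace_trD _) hτ
  · have hT : ∀ h : L2b D, (Γ h - Γ (trD Ω D (W h)) : L2b D) =ᵐ[surf D]
        fun x => (γ x : ℂ) * (h x - trD Ω D (W h) x) := fun h => by
      filter_upwards [hΓ h, hΓ (trD Ω D (W h)), Lp.coeFn_sub (Γ h) (Γ (trD Ω D (W h)))]
        with x h1 h2 h3
      rw [h3, Pi.sub_apply, h1, h2, mul_sub]
    refine fun h k => ⟨fun hk => ⟨_, _, src h, isTrace_trD _, hk ▸ hT h⟩,
      fun ⟨w, τ, hw, hτ, hk⟩ => ?_⟩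
    rw [H.sourceSol_unique hΓ hw (src h)] at hτ
    rw [H.trace_unique hτ (isTrace_trD _)] at hk
    exact Lp.ext ((hT h).trans (EventuallyEq.symm hk))
  · have hVy : ∀ g, ∀ φ ∈ TrSpace₀ Ω D, inner ℂ φ (formOp (gradT Ω D) (trD Ω D) Γ (V g)
        + (trD Ω D).adjoint g) = 0 := fun g φ hφ => by
      rw [inner_add_right, hV g φ hφ, inner_neg_right]
      exact neg_add_cancel _
    have neu : ∀ g, IsNeumannTrace (closure D) (toH1 Ω D (V g))
        (adj ((trD Ω D).comp U₁) g) := fun g =>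
      H.isNeumannTrace_of hL (hVy g) (z := Γ (trD Ω D (V g)) + g) (fun φ => by
        rw [inner_add_right, inner_add_right, ContinuousLinearMap.adjoint_inner_right,
          inner_formOp, add_assoc])
        (fun φ => inner_trace_eq hΓs (hU₁ φ) (hLU₁ φ) (hVm g) (hVy g))
        (Or.inl frontier_subset_closure)
    refine fun g ℓ => ⟨fun h => ⟨_, adjs g, h ▸ neu g⟩, fun ⟨v, hv, hℓ⟩ => ?_⟩
    rw [H.adjointSol_unique hγ' hΓ hv (adjs g)] at hℓ
    exact H.neumannTrace_unique isClosed_closure H.closure_subset (neu g) hℓ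
  · ext f φ
    have hdiff : U₁ f - U₀ f ∈ TrSpace₀ Ω D :=
      sub_mem_trSpace₀ (hUt (hLU₁ f)) (hUt (hLU₀ f))
    have hw := sub_eq_source_solution hc hQ (hU₁ f) (hU₀ f) hdiff (hWm _) (hW _)
    have hT : Γ (trD Ω D (U₁ f)) - Γ (trD Ω D (W (trD Ω D (U₁ f)))) = Γ (trD Ω D (U₀ f)) := by
      rw [← hw, map_sub, map_sub, sub_sub_cancel]
    change _ = inner ℂ (trD Ω D (U₁ φ)) (Γ (trD Ω D (U₁ f)) - Γ (trD Ω D (W (trD Ω D (U₁ f)))))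
    rw [hT]
    exact formOp_sub_eq hΓs (hU₁ f) (hU₀ f) (hU₁ φ) hdiff (hLU₁ φ)
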